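/- **Asymptotic optimality of segment-based estimators.** For $p\ge 1$ consider the grid with vertex set $\mathcal V_p=\{0,\dots,p\}^2$; its road segments $s\in\mathcal S_p$ are the directed edges between vertices at grid distance $1$, where $\|(i_1,j_1)-(i_2,j_2)\|_1=|i_1-i_2|+|j_1-j_2|$. A route is a nonempty sequence of distinct segments, each starting where the previous one ends; $\mathcal Y_p$ is the set of routes. *Route distribution $\mu_p$.* Fix $0<\alpha\le 1$. Origin $x_1$ and destination $x_2$ are independent with $$\mathbb P[X=(i,j)]=\prod_{k\in\{i,j\}}\binom pk\frac{B(\alpha+k,\alpha+p-k)}{B(\alpha,\alpha)},$$ conditioned on $x_1\ne x_2$; given $x_1,x_2$, the route is uniform among the routes from $x_1$ to $x_2$ of length $\|x_1-x_2\|_1$ that have the fewest turns (a turn is a pair of consecutive segments with different directions of travel). The historical routes $Y_1,\dots,Y_N$ and the predicting route $Y$ are i.i.d. with law $\mu_p$, where $N=N(p)$. *Travel times.* Fix $\mu\in\mathbb R$ and $\tau^2>0$. The segment means $\theta_s$, $s\in\mathcal S_p$, are i.i.d. $\mathcal N(\mu,\tau^2)$. On each historical trip $n$ one observes the adjusted travel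 times $T'_{n,s}=\theta_s+\varepsilon_{n,s}$, $s\in Y_n$, where the error vectors of different trips are independent centred Gaussian with covariances $\sigma_{s,t}$, and errors, means and routes are independent. The matrices $\Sigma_p=[\sigma_{s,t}]_{s,t\in\mathcal S_p}$ are positive definite, and with $\Psi_p=\Sigma_p^{-1}=[\psi_{s,t}]$ there are constants $C_0<\infty$ and $\sigma_{\min}>0$, independent of $p$, such that $\sum_t|\sigma_{s,t}|\le C_0$ and $\sum_t|\psi_{s,t}|\le C_0$ for all $p$ and $s\in\mathcal S_p$, and $\sum_{s,t\in y}\sigma_{s,t}\ge\sigma_{\min}$ for all $p$ and $y\in\mathcal Y_p$. *Estimators and risk.* An estimator $\hat\Theta_Y$ is a measurable function of the predicting route, the historical routes and the observed $T'_{n,s}$. Its integrated risk is $R(\hat\Theta_Y)=\mathbb E\big[(\hat\Theta_Y-\sum_{s\in Y}\theta_s)^2\big]\in[0,\infty]$, with the expectation over routes, errors and segment means. Let $R(\hat\Theta^*_{Y_p})$ be the optimal (Bayes) risk, i.e. the least integrated risk among all estimators. A segment-based estimator is $$\hat\Theta^{(\mathrm{seg})}_Y=\sum_{s\in Y}\Big((1-\phi_s(N_s))\mu+\phi_s(N_s)\frac{\sum_{n:\,s\in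 Y_n}T'_{n,s}}{N_s}\Big),\qquad N_s=|\{n:s\in Y_n\}|,\quad 0/0:=0,$$ with functions $\phi_s:\mathbb Z_{\ge0}\to\mathbb R$ satisfying $\phi_s(0)=0$. *Claims.* 1. If $1/2\le\alpha\le1$ and $N=\omega(p)$ (i.e. $N/p\to\infty$), then for every family of segment-based estimators with $\phi_s(n)=1-\mathcal O(1/\sqrt n)$ uniformly, that is, $|1-\phi_s(n)|\le C/\sqrt n$ for all $n\ge1$, all $s\in\mathcal S_p$ and all $p$ with one constant $C$, the optimal risk is positive and finite for all large $p$ and $$\frac{R(\hat\Theta^{(\mathrm{seg})}_{Y_p})}{R(\hat\Theta^*_{Y_p})}=\mathcal O(\log p)\qquad(p\to\infty).$$ 2. If $0<\alpha\le1$ and $N=\mathcal O(p)$, then $\liminf_{p\to\infty}R(\hat\Theta_{Y_p})>0$ for every sequence of estimators $\hat\Theta_{Y_p}$. -/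

import Mathlib

open Filter Topology MeasureTheory ProbabilityTheory
open scoped ENNReal NNReal BigOperators

namespace GridTravel

/-! ### The grid network -/

/-- Vertices of the grid of size `p`: the set `{0, …, p}²`. -/
abbrev Vertex (p : ℕ) : Type := Fin (p + 1) × Fin (p + 1)

/-- Grid distance `|i₁ - i₂| + |j₁ - j₂|`. -/
def gridDist {p : ℕ} (x y : Vertex p) : ℕ :=
  ((x.1 : ℤ) - (y.1 : ℤ)).natAbs + ((x.2 : ℤ) - (y.2 : ℤ)).natAbs

/-- Road segments: directed edges `(tail, head)` between adjacent vertices. -/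
abbrev Segment (p : ℕ) : Type := {e : Vertex p × Vertex p // gridDist e.1 e.2 = 1}

/-- The direction of travel on a segment, as a unit vector of `ℤ²`. -/
def direction {p : ℕ} (s : Segment p) : ℤ × ℤ :=
  ((s.1.2.1 : ℤ) - (s.1.1.1 : ℤ), (s.1.2.2 : ℤ) - (s.1.1.2 : ℤ))

/-- Routes: nonempty sequences of distinct segments, each starting where the previous one ends. -/
abbrev Route (p : ℕ) : Type :=
  {l : List (Segment p) // l ≠ [] ∧ l.Nodup ∧ l.IsChain (fun s t => s.1.2 = t.1.1)}

/-- There are only finitely many routes. -/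
noncomputable instance routeFintype (p : ℕ) : Fintype (Route p) :=
  Fintype.ofInjective
    (fun y : Route p => (⟨y.1, y.2.2.1⟩ : {l : List (Segment p) // l.Nodup}))
    (fun _ _ h => Subtype.ext (congrArg (fun z : {l : List (Segment p) // l.Nodup} => z.1) h))

namespace Route

/-- The set of segments of a route. -/
def segs {p : ℕ} (y : Route p) : Finset (Segment p) := y.1.toFinset

/-- The origin of a route. -/
def origin {p : ℕ} (y : Route p) : Vertex p := (y.1.head y.2.1).1.1

/-- The destination of a route. -/
def dest {p : ℕ} (y : Route p) : Vertex p := (y.1.getLast y.2.1).1.2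

/-- The number of turns: consecutive segments with different directions of travel. -/
def turns {p : ℕ} (y : Route p) : ℕ :=
  (y.1.zip y.1.tail).countP (fun st => decide (direction st.1 ≠ direction st.2))

end Route

/-! ### The route distribution -/

/-- The symmetric beta-binomial weights `C(p,k) B(α+k, α+p-k) / B(α,α)`, `0 ≤ k ≤ p`. -/
noncomputable def betaBinomial (α : ℝ) (p : ℕ) (k : Fin (p + 1)) : ℝ :=
  (p.choose k : ℝ) * beta (α + (k : ℕ)) (α + ((p : ℝ) - (k : ℕ))) / beta α α

/-- The probability that a vertex with independent beta-binomial coordinates equals `x`. -/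
noncomputable def vertexProb (α : ℝ) (p : ℕ) (x : Vertex p) : ℝ :=
  betaBinomial α p x.1 * betaBinomial α p x.2

/-- The law of the pair (origin, destination): two independent vertices with law `vertexProb`,
conditioned to be distinct (a route has at least one segment). -/
noncomputable def odProb (α : ℝ) (p : ℕ) (x₁ x₂ : Vertex p) : ℝ :=
  if x₁ = x₂ then 0
  else vertexProb α p x₁ * vertexProb α p x₂ /
    ∑ u : Vertex p, ∑ v : Vertex p, if u = v then 0 else vertexProb α p u * vertexProb α p v

/-- The routes from `x₁` to `x₂` of length equal to the grid distance. -/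
noncomputable def shortestRoutes {p : ℕ} (x₁ x₂ : Vertex p) : Finset (Route p) :=
  Finset.univ.filter fun y => y.origin = x₁ ∧ y.dest = x₂ ∧ y.1.length = gridDist x₁ x₂

/-- The shortest routes from `x₁` to `x₂` with the minimum number of turns. -/
noncomputable def fewestTurnRoutes {p : ℕ} (x₁ x₂ : Vertex p) : Finset (Route p) :=
  (shortestRoutes x₁ x₂).filter fun y => ∀ y' ∈ shortestRoutes x₁ x₂, y.turns ≤ y'.turns

open Classical in
/-- The route distribution `μ_p`: origin and destination have law `odProb`, and given these the
route is uniform among the shortest routes with the fewest turns. -/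
noncomputable def routeProb (α : ℝ) (p : ℕ) (y : Route p) : ℝ :=
  odProb α p y.origin y.dest *
    if y ∈ fewestTurnRoutes y.origin y.dest
    then (1 : ℝ) / ((fewestTurnRoutes y.origin y.dest).card : ℝ) else 0

/-! ### Data, estimators and integrated risk -/

/-- Index set of the observed (adjusted) segment travel times when the historical routes are `ys`:
pairs of a trip `n` and a segment of the route of that trip. -/
abbrev ObsIndex {p N : ℕ} (ys : Fin N → Route p) : Type :=
  Σ n : Fin N, {s : Segment p // s ∈ (ys n).segs}

/-- The number `N_s` of historical trips that traverse the segment `s`. -/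
def traversals {p N : ℕ} (ys : Fin N → Route p) (s : Segment p) : ℕ :=
  (Finset.univ.filter fun n : Fin N => s ∈ (ys n).segs).card

/-- An estimator: a function of the predicting route, the historical routes and the observed
adjusted segment travel times on the historical routes. -/
abbrev Estimator (p N : ℕ) : Type :=
  Route p → (ys : Fin N → Route p) → (ObsIndex ys → ℝ) → ℝ

/-- Measurability of an estimator (in the observed travel times, for all routes). -/
def Estimator.IsMeasurable {p N : ℕ} (T : Estimator p N) : Prop :=
  ∀ (y : Route p) (ys : Fin N → Route p), Measurable (T y ys)

/-- The segment-based estimator with weights `φ`: the sum over the segments `s` of the predicting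
route of `(1 - φ_s(N_s)) m + φ_s(N_s) (∑_{n : s ∈ y_n} T'_{n,s}) / N_s`, where `0 / 0 = 0`. -/
noncomputable def segmentEstimator {p : ℕ} (N : ℕ) (m : ℝ) (φ : Segment p → ℕ → ℝ) :
    Estimator p N := fun y ys z =>
  ∑ s ∈ y.segs, ((1 - φ s (traversals ys s)) * m +
    φ s (traversals ys s) *
      ((∑ i ∈ Finset.univ.filter (fun i : ObsIndex ys => i.2.1 = s), z i) /
        (traversals ys s : ℝ)))

/-- The joint law of `(θ, ε)`: the segment means `θ_s` are i.i.d. Gaussian with mean `m` and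
variance `v`, the error vectors `ε_n` of the trips are i.i.d. centred Gaussian with covariance
matrix `S`, and `θ` and `ε` are independent. -/
noncomputable def modelLaw (p N : ℕ) (m : ℝ) (v : ℝ≥0) (S : Matrix (Segment p) (Segment p) ℝ) :
    Measure ((Segment p → ℝ) × (Fin N → EuclideanSpace ℝ (Segment p))) :=
  (Measure.pi fun _ : Segment p => gaussianReal m v).prod
    (Measure.pi fun _ : Fin N => multivariateGaussian 0 S)

/-- The observed adjusted travel times `T'_{n,s} = θ_s + ε_{n,s}`, `s ∈ y_n`. -/
def observations {p N : ℕ} (ys : Fin N → Route p)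
    (ω : (Segment p → ℝ) × (Fin N → EuclideanSpace ℝ (Segment p))) : ObsIndex ys → ℝ :=
  fun i => ω.1 i.2.1 + ω.2 i.1 i.2.1

/-- The integrated risk given the predicting route `y` and the historical routes `ys`:
the mean squared error for the total mean travel time `∑_{s ∈ y} θ_s`. -/
noncomputable def conditionalRisk {p N : ℕ} (m : ℝ) (v : ℝ≥0)
    (S : Matrix (Segment p) (Segment p) ℝ) (T : Estimator p N)
    (y : Route p) (ys : Fin N → Route p) : ℝ≥0∞ :=
  ∫⁻ ω, ENNReal.ofReal ((T y ys (observations ys ω) - ∑ s ∈ y.segs, ω.1 s) ^ 2)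
    ∂(modelLaw p N m v S)

/-- The integrated risk, averaged also over the `N` historical routes and the predicting route,
which are i.i.d. with the route distribution `routeProb`. -/
noncomputable def risk {p N : ℕ} (α m : ℝ) (v : ℝ≥0)
    (S : Matrix (Segment p) (Segment p) ℝ) (T : Estimator p N) : ℝ≥0∞ :=
  ∑ ys : Fin N → Route p, ∑ y : Route p,
    ENNReal.ofReal ((∏ n, routeProb α p (ys n)) * routeProb α p y) * conditionalRisk m v S T y ys

/-- The optimal (Bayes) risk: the least integrated risk among all estimators. -/
noncomputable def optimalRisk (p N : ℕ) (α m : ℝ) (v : ℝ≥0)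
    (S : Matrix (Segment p) (Segment p) ℝ) : ℝ≥0∞ :=
  ⨅ (T : Estimator p N) (_ : T.IsMeasurable), risk α m v S T

/-! ### Asymptotic conditions -/

/-- The conditions on the covariance matrices `S p` of the errors and on the precision matrices
`(S p)⁻¹`: they are positive definite, the absolute row sums of both are bounded uniformly in the
row and in `p`, and the error variances of routes are bounded below by a positive constant. -/
def CovarianceCondition (S : ∀ p : ℕ, Matrix (Segment p) (Segment p) ℝ) : Prop :=
  (∀ p, (S p).PosDef) ∧
  (∃ C : ℝ, ∀ p s, ∑ t, |S p s t| ≤ C ∧ ∑ t, |(S p)⁻¹ s t| ≤ C) ∧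
  (∃ c : ℝ, 0 < c ∧ ∀ (p : ℕ) (y : Route p), c ≤ ∑ s ∈ y.segs, ∑ t ∈ y.segs, S p s t)

/-- Weights of a simple segment-based estimator: `φ_s(0) = 0` and `φ_s(n) = 1 - O(1/√n)`, with a
constant that is uniform in the segment `s` and in the grid size `p`. -/
def SimpleWeights (φ : ∀ p : ℕ, Segment p → ℕ → ℝ) : Prop :=
  (∀ p s, φ p s 0 = 0) ∧
  ∃ C : ℝ, ∀ (p : ℕ) (s : Segment p) (n : ℕ), 1 ≤ n → |1 - φ p s n| ≤ C / Real.sqrt n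

end GridTravel

open GridTravel

/-! Given the routes, everything is Gaussian, and both claims reduce to comparing quadratic forms
with the diagonal form that has one term per segment. The absolute row sums of `S⁻¹` bound its
quadratic form by `b` times the squared norm (Schur), so a traversal of `s` yields information at
most `b`. Hence, for every estimator, the conditional risk is at least `∑ s ∈ y, 1 / (1/v + b N_s)`
(`le_conditionalRisk`). The row sums of `S` bound the risk of a segment-based estimator by `∑ s ∈ y,
(v (1 - φ_s)² + b φ_s² / N_s)` (`conditionalRisk_segmentEstimator_le`), and the condition on `φ`
makes each term `O(1 / (N_s + 1))`.

It remains to average over the routes. Each `N_s` is binomial with parameters `N` and `q_s`, the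
probability that a random route contains `s`. Jensen's inequality bounds the first sum below by
terms `1 / (1/v + b N q_s)`. The second is bounded above by a constant multiple of the same terms,
since the mean of `1 / (N_s + 1)` is at most `min(1, 1 / ((N + 1) q_s))`. So the risk ratio is
bounded by a constant, and a constant is at most a multiple of `log p`.

For the second claim, `N_s ≤ N` makes every segment of the route cost at least `1 / (1/v + b N)`,
which is of order at least `1/p`. The mean route length is at least `p / 6`, by the first two
moments of the beta-binomial law, so the product stays away from zero. -/

namespace GridTravel

/-! ### The Gaussian model -/

/-- A Bayesian lower bound for the mean squared error: if `U` is independent of the data `Z`, then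
no function of `Z` predicts `g` with mean squared error below `2 cov(g, U) - Var U`. -/
theorem ofReal_le_lintegral_sq_of_indepFun {Ω κ : Type*} [MeasurableSpace Ω] [MeasurableSpace κ]
    {P : Measure Ω} [IsProbabilityMeasure P] {Z : Ω → κ} {U g : Ω → ℝ} {h : κ → ℝ}
    (hh : Measurable h) (hZ : Measurable Z) (hU : MemLp U 2 P) (hg : MemLp g 2 P)
    (hgm : Measurable g) (hUZ : IndepFun U Z P) :
    ENNReal.ofReal (2 * cov[g, U; P] - Var[U; P]) ≤
      ∫⁻ ω, ENNReal.ofReal ((h (Z ω) - g ω) ^ 2) ∂P := by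
  by_cases htop : ∫⁻ ω, ENNReal.ofReal ((h (Z ω) - g ω) ^ 2) ∂P = ⊤
  · simp [htop]
  set D : Ω → ℝ := (h ∘ Z) - g with hD
  have hDm : Measurable D := (hh.comp hZ).sub hgm
  have hDint : Integrable (fun ω => D ω ^ 2) P := by
    refine ⟨(hDm.pow_const 2).aestronglyMeasurable, ?_⟩
    rw [hasFiniteIntegral_iff_ofReal (Eventually.of_forall fun ω => sq_nonneg (D ω))]
    exact lt_of_le_of_ne le_top htop
  have hDL : MemLp D 2 P := (memLp_two_iff_integrable_sq hDm.aestronglyMeasurable).2 hDint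
  have hTL : MemLp (h ∘ Z) 2 P := by
    have := hDL.add hg
    simpa [hD] using this
  have hcov : cov[D, U; P] = - cov[g, U; P] := by
    rw [hD, covariance_sub_left hTL hg hU]
    have : IndepFun (h ∘ Z) U P := (hUZ.symm.comp hh measurable_id)
    rw [this.covariance_eq_zero hTL hU, zero_sub]
  -- Since `cov[D, U] = -cov[g, U]`, expanding this variance gives `Var D ≥ 2 cov[g, U] - Var U`,
  -- whatever `h` is.
  have hvar : 0 ≤ Var[D + U; P] := variance_nonneg _ _
  rw [variance_add hDL hU, hcov] at hvar
  have hle : Var[D; P] ≤ ∫ ω, D ω ^ 2 ∂P := variance_le_expectation_sq hDm.aestronglyMeasurable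
  have : ∫⁻ ω, ENNReal.ofReal ((h (Z ω) - g ω) ^ 2) ∂P = ENNReal.ofReal (∫ ω, D ω ^ 2 ∂P) :=
    (ofReal_integral_eq_lintegral_ofReal hDint
      (Eventually.of_forall fun ω => sq_nonneg (D ω))).symm
  rw [this]
  exact ENNReal.ofReal_le_ofReal (by linarith)

/-- Schur's bound for a quadratic form in terms of the absolute row sums. -/
theorem sum_sum_mul_le_of_absRowSum_le {ι : Type*} [Fintype ι] {M : Matrix ι ι ℝ}
    (hM : M.IsSymm) {C : ℝ} (hC : ∀ s, ∑ t, |M s t| ≤ C) (x : ι → ℝ) :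
    ∑ s, ∑ t, x s * x t * M s t ≤ C * ∑ s, x s ^ 2 := by
  -- AM-GM in each entry; writing one half with `M t s` makes both halves row sums after a swap of
  -- the summations.
  have h1 : ∀ s t, x s * x t * M s t ≤ (x s ^ 2 * |M s t| + x t ^ 2 * |M t s|) / 2 := by
    intro s t
    rw [hM.apply s t]
    have h2 : x s * x t * M s t ≤ |x s * x t| * |M s t| := by
      rw [← abs_mul]; exact le_abs_self _
    have h3 : |x s * x t| ≤ (x s ^ 2 + x t ^ 2) / 2 := by
      rw [abs_le]; constructor <;> nlinarith [sq_nonneg (x s - x t), sq_nonneg (x s + x t)]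
    nlinarith [abs_nonneg (M s t)]
  calc ∑ s, ∑ t, x s * x t * M s t
      ≤ ∑ s, ∑ t, (x s ^ 2 * |M s t| + x t ^ 2 * |M t s|) / 2 :=
        Finset.sum_le_sum fun s _ => Finset.sum_le_sum fun t _ => h1 s t
    _ = ∑ s, x s ^ 2 * ∑ t, |M s t| := by
        simp_rw [← Finset.sum_div, Finset.sum_add_distrib]
        rw [Finset.sum_comm (f := fun s t => x t ^ 2 * |M t s|)]
        simp_rw [Finset.mul_sum]
        ring
    _ ≤ ∑ s, x s ^ 2 * C :=
        Finset.sum_le_sum fun s _ => mul_le_mul_of_nonneg_left (hC s) (sq_nonneg _)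
    _ = C * ∑ s, x s ^ 2 := by rw [← Finset.sum_mul, mul_comm]

/-- Independent Gaussian coordinates are jointly Gaussian. Joint normality of means and errors is
what later turns vanishing covariance into independence. -/
theorem isGaussian_pi {ι : Type*} [Fintype ι] {E : ι → Type*} [∀ i, NormedAddCommGroup (E i)]
    [∀ i, NormedSpace ℝ (E i)] [∀ i, MeasurableSpace (E i)] [∀ i, BorelSpace (E i)]
    [∀ i, SecondCountableTopology (E i)] [∀ i, CompleteSpace (E i)]
    (P : ∀ i, Measure (E i)) [∀ i, IsGaussian (P i)] : IsGaussian (Measure.pi P) := by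
  have hind : iIndepFun (fun i (ω : ∀ i, E i) => ω i) (Measure.pi P) :=
    iIndepFun_pi (X := fun _ => id) (fun _ => aemeasurable_id)
  have h := iIndepFun.hasGaussianLaw (X := fun i (ω : ∀ i, E i) => ω i) (P := Measure.pi P)
    (fun i => ⟨by rw [(measurePreserving_eval P i).map_eq]; infer_instance⟩) hind
  have h2 := h.isGaussian_map
  simpa using h2

/-! ### Means and covariances of linear functionals of `(θ, ε)` -/

section Model

variable {p N : ℕ}

instance isGaussian_modelLaw (m : ℝ) (v : ℝ≥0) (S : Matrix (Segment p) (Segment p) ℝ) :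
    IsGaussian (modelLaw p N m v S) := by
  have := isGaussian_pi (fun _ : Segment p => gaussianReal m v)
  have := isGaussian_pi (fun _ : Fin N => multivariateGaussian (0 : EuclideanSpace ℝ (Segment p)) S)
  unfold modelLaw
  infer_instance

/-- The coordinates of the pair `(θ, ε)`. -/
noncomputable def modelCoord : Segment p ⊕ Fin N × Segment p →
    ((Segment p → ℝ) × (Fin N → EuclideanSpace ℝ (Segment p)) →L[ℝ] ℝ)
  | Sum.inl s => (ContinuousLinearMap.proj s).comp (ContinuousLinearMap.fst ℝ _ _)
  | Sum.inr k => (EuclideanSpace.proj k.2).comp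
      ((ContinuousLinearMap.proj k.1).comp (ContinuousLinearMap.snd ℝ _ _))

@[simp] theorem modelCoord_inl (s : Segment p)
    (ω : (Segment p → ℝ) × (Fin N → EuclideanSpace ℝ (Segment p))) :
    modelCoord (Sum.inl s) ω = ω.1 s := rfl

@[simp] theorem modelCoord_inr (k : Fin N × Segment p)
    (ω : (Segment p → ℝ) × (Fin N → EuclideanSpace ℝ (Segment p))) :
    modelCoord (Sum.inr k) ω = ω.2 k.1 k.2 := rfl

/-- The linear functional of `(θ, ε)` with coefficients `a` and `c`. -/
noncomputable def modelFunctional (a : Segment p → ℝ) (c : Fin N → Segment p → ℝ) :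
    (Segment p → ℝ) × (Fin N → EuclideanSpace ℝ (Segment p)) →L[ℝ] ℝ :=
  ∑ j, Sum.elim a (fun k => c k.1 k.2) j • modelCoord j

theorem modelFunctional_apply (a : Segment p → ℝ) (c : Fin N → Segment p → ℝ)
    (ω : (Segment p → ℝ) × (Fin N → EuclideanSpace ℝ (Segment p))) :
    modelFunctional a c ω = ∑ s, a s * ω.1 s + ∑ n, ∑ s, c n s * ω.2 n s := by
  simp [modelFunctional, Fintype.sum_sum_type, Fintype.sum_prod_type]

theorem memLp_modelLaw (m : ℝ) (v : ℝ≥0) (S : Matrix (Segment p) (Segment p) ℝ)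
    (L : (Segment p → ℝ) × (Fin N → EuclideanSpace ℝ (Segment p)) →L[ℝ] ℝ) :
    MemLp L 2 (modelLaw p N m v S) :=
  IsGaussian.memLp_dual _ L 2 (by simp)

theorem covariance_modelCoord_inl_inl (m : ℝ) (v : ℝ≥0) (S : Matrix (Segment p) (Segment p) ℝ)
    (s t : Segment p) :
    cov[modelCoord (N := N) (Sum.inl s), modelCoord (Sum.inl t); modelLaw p N m v S] =
      if s = t then (v : ℝ) else 0 := by
  have := isGaussian_pi (fun _ : Segment p => gaussianReal m v)
  have hmp : (modelLaw p N m v S).map Prod.fst = Measure.pi fun _ : Segment p => gaussianReal m v :=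
    measurePreserving_fst.map_eq
  have hX : ∀ s : Segment p, ⇑(modelCoord (N := N) (Sum.inl s)) =
      (fun θ : Segment p → ℝ => θ s) ∘ Prod.fst := fun s => rfl
  have hm : ∀ s : Segment p, Measurable (fun θ : Segment p → ℝ => θ s) := measurable_pi_apply
  rw [hX, hX, ← covariance_map (hm s).aestronglyMeasurable (hm t).aestronglyMeasurable
    measurable_fst.aemeasurable, hmp]
  split_ifs with h
  · subst h
    rw [covariance_self (hm s).aemeasurable]
    have h2 := variance_map (μ := Measure.pi fun _ : Segment p => gaussianReal m v)
      (X := (id : ℝ → ℝ)) (Y := fun θ => θ s) aemeasurable_id (hm s).aemeasurable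
    rw [(measurePreserving_eval (fun _ : Segment p => gaussianReal m v) s).map_eq,
      variance_id_gaussianReal] at h2
    exact h2.symm
  · have hind : iIndepFun (fun i (ω : Segment p → ℝ) => ω i)
        (Measure.pi fun _ : Segment p => gaussianReal m v) :=
      iIndepFun_pi (X := fun _ => id) (fun _ => aemeasurable_id)
    have hL : ∀ s : Segment p, MemLp (fun θ : Segment p → ℝ => θ s) 2
        (Measure.pi fun _ : Segment p => gaussianReal m v) := fun s =>
      IsGaussian.memLp_dual _ (ContinuousLinearMap.proj s : (Segment p → ℝ) →L[ℝ] ℝ) 2 (by simp)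
    exact (hind.indepFun h).covariance_eq_zero (hL s) (hL t)

theorem covariance_modelCoord_inl_inr (m : ℝ) (v : ℝ≥0) (S : Matrix (Segment p) (Segment p) ℝ)
    (s : Segment p) (k : Fin N × Segment p) :
    cov[modelCoord (Sum.inl s), modelCoord (Sum.inr k); modelLaw p N m v S] = 0 := by
  refine IndepFun.covariance_eq_zero ?_ (memLp_modelLaw m v S _) (memLp_modelLaw m v S _)
  exact indepFun_prod (X := fun θ : Segment p → ℝ => θ s)
    (Y := fun e : Fin N → EuclideanSpace ℝ (Segment p) => e k.1 k.2) (by fun_prop) (by fun_prop)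

theorem covariance_modelCoord_inr_inr (m : ℝ) (v : ℝ≥0) {S : Matrix (Segment p) (Segment p) ℝ}
    (hS : S.PosSemidef) (k l : Fin N × Segment p) :
    cov[modelCoord (Sum.inr k), modelCoord (Sum.inr l); modelLaw p N m v S] =
      if k.1 = l.1 then S k.2 l.2 else 0 := by
  have := isGaussian_pi (fun _ : Fin N => multivariateGaussian (0 : EuclideanSpace ℝ (Segment p)) S)
  have hmp : (modelLaw p N m v S).map Prod.snd = Measure.pi fun _ : Fin N =>
    multivariateGaussian (0 : EuclideanSpace ℝ (Segment p)) S := measurePreserving_snd.map_eq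
  have hX : ∀ k : Fin N × Segment p, ⇑(modelCoord (Sum.inr k)) =
      (fun e : Fin N → EuclideanSpace ℝ (Segment p) => e k.1 k.2) ∘ Prod.snd := fun k => rfl
  have hm : ∀ k : Fin N × Segment p,
      Measurable (fun e : Fin N → EuclideanSpace ℝ (Segment p) => e k.1 k.2) := by
    intro k; fun_prop
  rw [hX, hX, ← covariance_map (hm k).aestronglyMeasurable (hm l).aestronglyMeasurable
    measurable_snd.aemeasurable, hmp]
  obtain ⟨n, s⟩ := k
  obtain ⟨n', t⟩ := l
  split_ifs with h
  · simp only at h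
    subst h
    have hm' : ∀ s : Segment p, Measurable (fun e : EuclideanSpace ℝ (Segment p) => e s) := by
      intro s; fun_prop
    have h2 := covariance_map (μ := Measure.pi fun _ : Fin N =>
        multivariateGaussian (0 : EuclideanSpace ℝ (Segment p)) S) (Z := Function.eval n)
      (hm' s).aestronglyMeasurable (hm' t).aestronglyMeasurable
      (measurable_pi_apply n).aemeasurable
    rw [(measurePreserving_eval (fun _ : Fin N =>
      multivariateGaussian (0 : EuclideanSpace ℝ (Segment p)) S) n).map_eq,
      covariance_eval_multivariateGaussian hS] at h2
    exact h2.symm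
  · have hind : iIndepFun (fun i (e : Fin N → EuclideanSpace ℝ (Segment p)) => e i)
        (Measure.pi fun _ : Fin N => multivariateGaussian (0 : EuclideanSpace ℝ (Segment p)) S) :=
      iIndepFun_pi (X := fun _ => id) (fun _ => aemeasurable_id)
    have hL : ∀ k : Fin N × Segment p,
        MemLp (fun e : Fin N → EuclideanSpace ℝ (Segment p) => e k.1 k.2) 2
        (Measure.pi fun _ : Fin N => multivariateGaussian (0 : EuclideanSpace ℝ (Segment p)) S) :=
      fun k => IsGaussian.memLp_dual _
        ((EuclideanSpace.proj k.2).comp (ContinuousLinearMap.proj k.1) :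
          (Fin N → EuclideanSpace ℝ (Segment p)) →L[ℝ] ℝ) 2 (by simp)
    exact ((hind.indepFun h).comp (φ := fun e : EuclideanSpace ℝ (Segment p) => e s)
      (ψ := fun e : EuclideanSpace ℝ (Segment p) => e t) (by fun_prop)
      (by fun_prop)).covariance_eq_zero (hL (n, s)) (hL (n', t))

/-- Bilinear expansion: means and errors are independent, as are distinct segment means and distinct
trips, so only these terms survive. All later Gaussian computations are instances of this formula.
-/
theorem covariance_modelFunctional (m : ℝ) (v : ℝ≥0) {S : Matrix (Segment p) (Segment p) ℝ}
    (hS : S.PosSemidef) (a a' : Segment p → ℝ) (c c' : Fin N → Segment p → ℝ) :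
    cov[modelFunctional a c, modelFunctional a' c'; modelLaw p N m v S] =
      v * ∑ s, a s * a' s + ∑ n, ∑ s, ∑ t, c n s * c' n t * S s t := by
  have h : ∀ (a : Segment p → ℝ) (c : Fin N → Segment p → ℝ), ⇑(modelFunctional a c) =
      fun ω => ∑ j, (Sum.elim a (fun k : Fin N × Segment p => c k.1 k.2) j) * modelCoord j ω := by
    intro a c; ext ω; simp [modelFunctional]
  rw [h, h, covariance_fun_sum_fun_sum
    (fun j => (memLp_modelLaw m v S (modelCoord j)).const_mul _)
    (fun j => (memLp_modelLaw m v S (modelCoord j)).const_mul _)]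
  simp_rw [covariance_const_mul_left, covariance_const_mul_right]
  simp only [Fintype.sum_sum_type, Sum.elim_inl, Sum.elim_inr, covariance_modelCoord_inl_inl,
    covariance_modelCoord_inl_inr, covariance_modelCoord_inr_inr m v hS,
    covariance_comm (modelCoord (Sum.inr _)) (modelCoord (Sum.inl _))]
  simp only [mul_zero, Finset.sum_const_zero, add_zero, zero_add, mul_ite, Finset.sum_ite_eq,
    Finset.mem_univ, if_true, Fintype.sum_prod_type]
  congr 1
  · rw [Finset.mul_sum]; exact Finset.sum_congr rfl fun s _ => by ring
  · refine Finset.sum_congr rfl fun n _ => Finset.sum_congr rfl fun s _ => ?_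
    rw [Finset.sum_comm]
    refine Finset.sum_congr rfl fun t _ => ?_
    simp [mul_assoc]

theorem integral_modelCoord_inl (m : ℝ) (v : ℝ≥0) (S : Matrix (Segment p) (Segment p) ℝ)
    (s : Segment p) : ∫ ω, ω.1 s ∂(modelLaw p N m v S) = m := by
  have h1 := (measurePreserving_fst (μ := Measure.pi fun _ : Segment p => gaussianReal m v)
    (ν := Measure.pi fun _ : Fin N =>
      multivariateGaussian (0 : EuclideanSpace ℝ (Segment p)) S))
  have h2 := (measurePreserving_eval (fun _ : Segment p => gaussianReal m v) s).comp h1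
  have h3 : ∫ x, x ∂(gaussianReal m v) = m := integral_id_gaussianReal
  rw [← h2.map_eq, integral_map h2.measurable.aemeasurable
    measurable_id'.aestronglyMeasurable] at h3
  exact h3

theorem integral_modelCoord_inr (m : ℝ) (v : ℝ≥0) (S : Matrix (Segment p) (Segment p) ℝ)
    (n : Fin N) (s : Segment p) : ∫ ω, ω.2 n s ∂(modelLaw p N m v S) = 0 := by
  have h1 := (measurePreserving_snd (μ := Measure.pi fun _ : Segment p => gaussianReal m v)
    (ν := Measure.pi fun _ : Fin N =>
      multivariateGaussian (0 : EuclideanSpace ℝ (Segment p)) S))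
  have h2 := (measurePreserving_eval (fun _ : Fin N =>
      multivariateGaussian (0 : EuclideanSpace ℝ (Segment p)) S) n).comp h1
  have h3 : ∫ x, (EuclideanSpace.proj s : EuclideanSpace ℝ (Segment p) →L[ℝ] ℝ) x
      ∂(multivariateGaussian (0 : EuclideanSpace ℝ (Segment p)) S) = 0 := by
    rw [ContinuousLinearMap.integral_comp_id_comm IsGaussian.integrable_id,
      integral_id_multivariateGaussian, map_zero]
  rw [← h2.map_eq, integral_map h2.measurable.aemeasurable
    (EuclideanSpace.proj s : EuclideanSpace ℝ (Segment p) →L[ℝ] ℝ).continuous.aestronglyMeasurable]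
    at h3
  exact h3

theorem integral_modelFunctional (m : ℝ) (v : ℝ≥0) (S : Matrix (Segment p) (Segment p) ℝ)
    (a : Segment p → ℝ) (c : Fin N → Segment p → ℝ) :
    ∫ ω, modelFunctional a c ω ∂(modelLaw p N m v S) = m * ∑ s, a s := by
  have hi : ∀ j : Segment p ⊕ Fin N × Segment p, Integrable (modelCoord j) (modelLaw p N m v S) :=
    fun j => (memLp_modelLaw m v S _).integrable (by norm_num)
  have h1 : ∀ s : Segment p, Integrable (fun ω => ω.1 s) (modelLaw p N m v S) :=
    fun s => hi (Sum.inl s)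
  have h2 : ∀ (n : Fin N) (s : Segment p), Integrable (fun ω => ω.2 n s) (modelLaw p N m v S) :=
    fun n s => hi (Sum.inr (n, s))
  simp_rw [modelFunctional_apply]
  rw [integral_add (integrable_finsetSum _ fun s _ => (h1 s).const_mul _)
    (integrable_finsetSum _ fun n _ => integrable_finsetSum _ fun s _ => (h2 n s).const_mul _),
    integral_finsetSum _ fun s _ => (h1 s).const_mul _,
    integral_finsetSum _ fun n _ => integrable_finsetSum _ fun s _ => (h2 n s).const_mul _]
  simp_rw [integral_const_mul, integral_modelCoord_inl]
  have : ∀ n : Fin N, ∫ ω, ∑ s, c n s * ω.2 n s ∂(modelLaw p N m v S) = 0 := by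
    intro n
    rw [integral_finsetSum _ fun s _ => (h2 n s).const_mul _]
    simp_rw [integral_const_mul, integral_modelCoord_inr, mul_zero, Finset.sum_const_zero]
  simp_rw [this, Finset.sum_const_zero, add_zero, ← Finset.sum_mul]
  ring

/-! ### Conditional risk bounds -/

theorem measurable_observations (ys : Fin N → Route p) : Measurable (observations ys) := by
  refine measurable_pi_lambda _ fun i => ?_
  exact (by fun_prop : Measurable fun ω : (Segment p → ℝ) × (Fin N → EuclideanSpace ℝ (Segment p))
    => ω.1 i.2.1 + ω.2 i.1 i.2.1)

theorem observations_eq_modelFunctional (ys : Fin N → Route p) (i : ObsIndex ys)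
    (ω : (Segment p → ℝ) × (Fin N → EuclideanSpace ℝ (Segment p))) :
    observations ys ω i =
      modelFunctional (Pi.single i.2.1 1) (Pi.single i.1 (Pi.single i.2.1 1)) ω := by
  rw [modelFunctional_apply, Finset.sum_eq_single i.1 (fun n _ hn => by simp [hn]) (by simp)]
  simp [observations, Pi.single_apply]

/-- Continuous linear functionals that are uncorrelated under a Gaussian measure are
independent. -/
theorem indepFun_of_covariance_dual_eq_zero {E κ : Type*} [NormedAddCommGroup E] [NormedSpace ℝ E]
    [MeasurableSpace E] [BorelSpace E] [Finite κ] (P : Measure E)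
    [IsGaussian P] (U : E →L[ℝ] ℝ) (O : κ → E →L[ℝ] ℝ) (h : ∀ i, cov[U, O i; P] = 0) :
    IndepFun U (fun ω i => O i ω) P := by
  have := Fintype.ofFinite κ
  have hg : HasGaussianLaw (fun ω => ((fun _ : Unit => U ω), fun i => O i ω)) P :=
    (IsGaussian.hasGaussianLaw_id (μ := P)).map_fun
      ((ContinuousLinearMap.pi fun _ : Unit => U).prod (ContinuousLinearMap.pi O))
  have h2 := HasGaussianLaw.indepFun_of_covariance_eval (X := fun (_ : Unit) ω => U ω)
    (Y := fun i ω => O i ω) hg (fun _ i => h i)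
  exact h2.comp (measurable_pi_apply ()) measurable_id

/-- A linear functional of the model that is uncorrelated with the observations is independent
of them. -/
theorem indepFun_observations (m : ℝ) (v : ℝ≥0) (S : Matrix (Segment p) (Segment p) ℝ)
    (ys : Fin N → Route p)
    (U : (Segment p → ℝ) × (Fin N → EuclideanSpace ℝ (Segment p)) →L[ℝ] ℝ)
    (h : ∀ i : ObsIndex ys, cov[U, modelFunctional (Pi.single i.2.1 1)
      (Pi.single i.1 (Pi.single i.2.1 1)); modelLaw p N m v S] = 0) :
    IndepFun U (observations ys) (modelLaw p N m v S) := by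
  have h4 : observations ys = fun ω (i : ObsIndex ys) =>
      modelFunctional (Pi.single i.2.1 1) (Pi.single i.1 (Pi.single i.2.1 1)) ω := by
    ext ω i; exact observations_eq_modelFunctional ys i ω
  rw [h4]
  exact indepFun_of_covariance_dual_eq_zero _ U _ h

theorem sum_ite_mem_segs (ys : Fin N → Route p) (s : Segment p) (x : ℝ) :
    ∑ n, (if s ∈ (ys n).segs then x else 0) = traversals ys s * x := by
  rw [← Finset.sum_filter, Finset.sum_const, nsmul_eq_mul, traversals]

/-- Lower bound for the conditional risk of any estimator. -/
theorem le_conditionalRisk (m : ℝ) {v : ℝ≥0} (hv : 0 < v) {S : Matrix (Segment p) (Segment p) ℝ}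
    (hS : S.PosDef) {b : ℝ} (hb : ∀ s, ∑ t, |S⁻¹ s t| ≤ b)
    (T : Estimator p N) (hT : T.IsMeasurable) (y : Route p) (ys : Fin N → Route p) :
    ENNReal.ofReal (∑ s ∈ y.segs, 1 / (1 / (v : ℝ) + b * traversals ys s)) ≤
      conditionalRisk m v S T y ys := by
  have hv' : (0 : ℝ) < v := hv
  by_cases hne : y.segs.Nonempty
  swap
  · simp [Finset.not_nonempty_iff_eq_empty.1 hne]
  have hb0 : 0 ≤ b := by
    obtain ⟨s, -⟩ := hne
    exact (Finset.sum_nonneg fun t _ => abs_nonneg _).trans (hb s)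
  have hdet : IsUnit S.det := (Matrix.isUnit_iff_isUnit_det S).1 hS.isUnit
  have hsym : S.IsSymm := by simpa using hS.isHermitian
  have hisym : S⁻¹.IsSymm := by
    have := hS.isHermitian.inv
    simpa using this
  -- `U` has weight `r s / v` on `θ_s` and `-(S⁻¹ P_n)` on `ε_n`, where `P_n` is `r` restricted to
  -- the route of trip `n`. Its covariance with `T'_{n,s}` is `r s - P_n s = 0`. The value of `r`
  -- solves `r² (1/v + b N_s) = r`, which maximizes the resulting lower bound termwise.
  set r : Segment p → ℝ :=
    fun s => if s ∈ y.segs then 1 / (1 / (v : ℝ) + b * traversals ys s) else 0 with hr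
  set P : Fin N → Segment p → ℝ := fun n s => if s ∈ (ys n).segs then r s else 0 with hP
  set U := modelFunctional (fun s => r s / v) (fun n => -(S⁻¹.mulVec (P n))) with hU
  set g := modelFunctional (N := N) (fun s => if s ∈ y.segs then (1 : ℝ) else 0) 0 with hg
  have hSP : ∀ n t, ∑ s, S⁻¹.mulVec (P n) s * S s t = P n t := by
    intro n t
    have : S.mulVec (S⁻¹.mulVec (P n)) t = P n t := by
      rw [Matrix.mulVec_mulVec, Matrix.mul_nonsing_inv _ hdet, Matrix.one_mulVec]
    rw [← this]
    simp only [Matrix.mulVec, dotProduct]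
    exact Finset.sum_congr rfl fun s _ => by rw [hsym.apply t s, mul_comm]
  have hind : IndepFun U (observations ys) (modelLaw p N m v S) := by
    refine indepFun_observations m v S ys U fun i => ?_
    rw [hU, covariance_modelFunctional m v hS.posSemidef,
      Finset.sum_eq_single i.1 (fun n _ hn => by simp [hn]) (by simp)]
    have h2 := hSP i.1 i.2.1
    simp [Pi.single_apply, h2]
    simp [hP, i.2.2]
    field_simp
    simp
  have hrsum : ∑ s, r s = ∑ s ∈ y.segs, 1 / (1 / (v : ℝ) + b * traversals ys s) := by
    simp [hr]
  have hcov : cov[g, U; modelLaw p N m v S] = ∑ s, r s := by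
    rw [hg, hU, covariance_modelFunctional m v hS.posSemidef, Finset.mul_sum]
    simp only [ite_mul, one_mul, zero_mul, mul_ite, mul_zero, Pi.zero_apply,
      Finset.sum_const_zero, add_zero]
    refine Finset.sum_congr rfl fun s _ => ?_
    split_ifs with h
    · field_simp
    · simp [hr, h]
  -- The error part of the variance is `∑ n, P_nᵀ S⁻¹ P_n`, at most `b ∑ s, N_s r_s²` by Schur's
  -- bound. With `cov[g, U] = ∑ r`, this leaves `2 ∑ r - ∑ r = ∑ r`.
  have hvar : Var[U; modelLaw p N m v S] ≤ ∑ s, r s := by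
    have hquad : ∀ n, ∑ s, ∑ t, (-(S⁻¹.mulVec (P n))) s * (-(S⁻¹.mulVec (P n))) t * S s t
        ≤ b * ∑ s, P n s ^ 2 := by
      intro n
      refine le_trans (le_of_eq ?_) (sum_sum_mul_le_of_absRowSum_le hisym hb (P n))
      rw [Finset.sum_comm]
      have : ∀ t, ∑ s, (-(S⁻¹.mulVec (P n))) s * (-(S⁻¹.mulVec (P n))) t * S s t =
          P n t * S⁻¹.mulVec (P n) t := by
        intro t
        rw [← hSP n t, Finset.sum_mul]
        exact Finset.sum_congr rfl fun s _ => by simp; ring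
      simp_rw [this, Matrix.mulVec, dotProduct, Finset.mul_sum]
      exact Finset.sum_congr rfl fun s _ => Finset.sum_congr rfl fun t _ => by ring
    rw [← covariance_self (U.continuous.measurable.aemeasurable), hU,
      covariance_modelFunctional m v hS.posSemidef]
    refine (add_le_add_right (Finset.sum_le_sum fun n _ => hquad n) _).trans (le_of_eq ?_)
    rw [← Finset.mul_sum, Finset.sum_comm]
    have hPs : ∀ s, ∑ n, P n s ^ 2 = traversals ys s * r s ^ 2 := by
      intro s
      rw [← sum_ite_mem_segs]
      exact Finset.sum_congr rfl fun n _ => by simp only [hP]; split_ifs <;> simp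
    simp_rw [hPs]
    rw [Finset.mul_sum, Finset.mul_sum, ← Finset.sum_add_distrib]
    refine Finset.sum_congr rfl fun s _ => ?_
    simp only [hr]
    split_ifs
    · have : (0 : ℝ) < 1 / (v : ℝ) + b * traversals ys s := by positivity
      field_simp
    · simp
  have hgapp : ∀ ω, g ω = ∑ s ∈ y.segs, ω.1 s := by
    intro ω; simp [hg, modelFunctional_apply]
  have hmain := ofReal_le_lintegral_sq_of_indepFun (hT y ys) (measurable_observations ys)
    (memLp_modelLaw m v S U) (memLp_modelLaw m v S g) g.continuous.measurable hind
  simp_rw [hgapp] at hmain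
  refine le_trans (ENNReal.ofReal_le_ofReal ?_) hmain
  rw [hcov, ← hrsum]
  linarith

theorem sum_observations_filter (ys : Fin N → Route p) (s : Segment p)
    (ω : (Segment p → ℝ) × (Fin N → EuclideanSpace ℝ (Segment p))) :
    ∑ i ∈ Finset.univ.filter (fun i : ObsIndex ys => i.2.1 = s), observations ys ω i =
      traversals ys s * ω.1 s + ∑ n, if s ∈ (ys n).segs then ω.2 n s else 0 := by
  rw [← sum_ite_mem_segs, ← Finset.sum_add_distrib, Finset.sum_filter, Fintype.sum_sigma]
  refine Finset.sum_congr rfl fun n _ => ?_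
  split_ifs with h
  · rw [Finset.sum_eq_single ⟨s, h⟩]
    · simp [observations]
    · rintro ⟨t, ht⟩ - hne
      rw [if_neg]
      simpa using hne
    · simp
  · rw [add_zero]
    refine Finset.sum_eq_zero fun t _ => if_neg ?_
    rintro rfl
    exact h t.2

/-- Upper bound for the conditional risk of a segment-based estimator. -/
theorem conditionalRisk_segmentEstimator_le (m : ℝ) (v : ℝ≥0)
    {S : Matrix (Segment p) (Segment p) ℝ} (hS : S.PosDef) {b : ℝ} (hb : ∀ s, ∑ t, |S s t| ≤ b)
    {φ : Segment p → ℕ → ℝ} (hφ : ∀ s, φ s 0 = 0) (y : Route p) (ys : Fin N → Route p) :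
    conditionalRisk m v S (segmentEstimator N m φ) y ys ≤
      ENNReal.ofReal (∑ s ∈ y.segs, (v * (1 - φ s (traversals ys s)) ^ 2 +
        b * (φ s (traversals ys s) ^ 2 / traversals ys s))) := by
  have hsym : S.IsSymm := by simpa using hS.isHermitian
  set f : Segment p → ℝ := fun s => φ s (traversals ys s) with hf
  set a : Segment p → ℝ := fun s => if s ∈ y.segs then -(1 - f s) else 0 with ha
  set c : Fin N → Segment p → ℝ := fun n s =>
    if s ∈ (ys n).segs then (if s ∈ y.segs then f s / traversals ys s else 0) else 0 with hc
  set F := modelFunctional a c with hF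
  -- The estimation error is a linear functional minus its mean: `a` carries the shrinkage `-(1 -
  -- φ_s)` on `θ_s`, and `c` the averaged trip errors. The mean squared error is therefore the
  -- variance of `F`.
  have hD : ∀ ω, segmentEstimator N m φ y ys (observations ys ω) - ∑ s ∈ y.segs, ω.1 s =
      F ω - m * ∑ s, a s := by
    intro ω
    have h1 : ∑ n, ∑ s, c n s * ω.2 n s = ∑ s ∈ y.segs, f s / traversals ys s *
        ∑ n, if s ∈ (ys n).segs then ω.2 n s else 0 := by
      rw [Finset.sum_comm, ← Finset.sum_subset (Finset.subset_univ y.segs)]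
      · refine Finset.sum_congr rfl fun s hs => ?_
        rw [Finset.mul_sum]
        refine Finset.sum_congr rfl fun n _ => ?_
        simp only [hc, hs, if_true]
        split_ifs <;> simp
      · intro s _ hs
        simp [hc, hs]
    rw [hF, modelFunctional_apply, h1]
    simp only [segmentEstimator, sum_observations_filter]
    have h2 : ∀ x : Segment p → ℝ, ∑ s, a s * x s = ∑ s ∈ y.segs, -(1 - f s) * x s := by
      intro x
      simp [ha]
    rw [h2, show ∑ s, a s = ∑ s, a s * 1 by simp, h2, Finset.mul_sum, ← Finset.sum_sub_distrib,
      ← Finset.sum_add_distrib, ← Finset.sum_sub_distrib]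
    refine Finset.sum_congr rfl fun s _ => ?_
    -- On an untraversed segment, `φ_s(0) = 0` makes the estimate the prior mean `m`.
    by_cases h0 : traversals ys s = 0
    · simp [hf, h0, hφ]; ring
    · have : (traversals ys s : ℝ) ≠ 0 := by exact_mod_cast h0
      simp only [hf]
      field_simp
      ring
  have hFL := memLp_modelLaw m v S F
  have hDL : MemLp (fun ω => F ω - m * ∑ s, a s) 2 (modelLaw p N m v S) :=
    hFL.sub (memLp_const _)
  have hint : ∫ ω, (F ω - m * ∑ s, a s) ∂(modelLaw p N m v S) = 0 := by
    rw [integral_sub (hFL.integrable (by norm_num)) (integrable_const _), hF,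
      integral_modelFunctional]
    simp
  have hvar : ∫ ω, (F ω - m * ∑ s, a s) ^ 2 ∂(modelLaw p N m v S) = Var[F; modelLaw p N m v S] := by
    rw [← variance_of_integral_eq_zero hDL.aemeasurable hint,
      variance_sub_const hFL.aestronglyMeasurable]
  unfold conditionalRisk
  simp_rw [hD]
  rw [← ofReal_integral_eq_lintegral_ofReal hDL.integrable_sq
    (Eventually.of_forall fun ω => sq_nonneg _), hvar]
  refine ENNReal.ofReal_le_ofReal ?_
  rw [← covariance_self hFL.aemeasurable, hF, covariance_modelFunctional m v hS.posSemidef]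
  refine (add_le_add_right (Finset.sum_le_sum fun n _ =>
    sum_sum_mul_le_of_absRowSum_le hsym hb (c n)) _).trans (le_of_eq ?_)
  rw [← Finset.mul_sum, Finset.sum_comm, Finset.sum_add_distrib, ← Finset.mul_sum,
    ← Finset.mul_sum]
  congr 2
  · simp [ha]
    exact Finset.sum_congr rfl fun s _ => by ring
  · have h : ∀ s, ∑ n, c n s ^ 2 =
        traversals ys s * (if s ∈ y.segs then f s / traversals ys s else 0) ^ 2 := by
      intro s
      rw [← sum_ite_mem_segs]
      exact Finset.sum_congr rfl fun n _ => by simp only [hc]; split_ifs <;> simp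
    simp_rw [h]
    rw [← Finset.sum_subset (Finset.subset_univ y.segs)]
    · refine Finset.sum_congr rfl fun s hs => ?_
      rw [if_pos hs]
      by_cases h0 : traversals ys s = 0
      · simp [h0]
      · have : (traversals ys s : ℝ) ≠ 0 := by exact_mod_cast h0
        simp only [hf]
        field_simp
    · intro s _ hs
      simp [hs]

end Model

/-! ### Counts in i.i.d. samples from a finite set -/

section Counts

variable {R : Type*} [Fintype R] {w : R → ℝ} (N : ℕ)

theorem sum_pi_prod (f : Fin N → R → ℝ) :
    ∑ ys : Fin N → R, ∏ n, f n (ys n) = ∏ n, ∑ y, f n y := by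
  rw [Finset.prod_univ_sum, Fintype.piFinset_univ]

theorem sum_pi_prod_eq_one (hw : ∑ y, w y = 1) : ∑ ys : Fin N → R, ∏ n, w (ys n) = 1 := by
  rw [sum_pi_prod N (fun _ => w)]
  simp [hw]

variable (A : R → Prop) [DecidablePred A]

/-- The binomial mean by linearity: the count is a sum of indicators, and the `k`-th one modifies
only the `k`-th factor of the product. -/
theorem sum_pi_prod_mul_card (hw : ∑ y, w y = 1) :
    ∑ ys : Fin N → R, (∏ n, w (ys n)) * ((Finset.univ.filter fun n => A (ys n)).card : ℝ) =
      N * ∑ y with A y, w y := by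
  have h : ∀ ys : Fin N → R, (∏ n, w (ys n)) * ((Finset.univ.filter fun n => A (ys n)).card : ℝ) =
      ∑ k : Fin N, ∏ n, w (ys n) * (if n = k then (if A (ys n) then 1 else 0) else 1) := by
    intro ys
    simp_rw [Finset.prod_mul_distrib, ← Finset.mul_sum, Finset.card_filter]
    push_cast
    congr 1
    exact Finset.sum_congr rfl fun k _ => by simp [Finset.prod_ite_eq']
  simp_rw [h]
  rw [Finset.sum_comm]
  have h2 : ∀ k : Fin N, ∑ ys : Fin N → R,
      ∏ n, w (ys n) * (if n = k then (if A (ys n) then 1 else 0) else 1) = ∑ y with A y, w y := by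
    intro k
    rw [sum_pi_prod N (fun n y => w y * (if n = k then (if A y then 1 else 0) else 1)),
      Finset.prod_eq_single k (fun n _ hn => by simp [hn, hw]) (by simp)]
    simp [Finset.sum_filter]
  simp only [h2, Finset.sum_const, Finset.card_univ, Fintype.card_fin, nsmul_eq_mul]

/-- The probability generating function of the binomial law; integrated over `[0, 1]`, it yields the
mean of `1 / (K + 1)`. -/
theorem sum_pi_prod_mul_pow_card (hw : ∑ y, w y = 1) (x : ℝ) :
    ∑ ys : Fin N → R, (∏ n, w (ys n)) * x ^ (Finset.univ.filter fun n => A (ys n)).card =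
      ((∑ y with A y, w y) * x + (1 - ∑ y with A y, w y)) ^ N := by
  have h : ∀ ys : Fin N → R, (∏ n, w (ys n)) * x ^ (Finset.univ.filter fun n => A (ys n)).card =
      ∏ n, w (ys n) * (if A (ys n) then x else 1) := by
    intro ys
    rw [Finset.prod_mul_distrib, Finset.prod_ite]
    simp
  simp_rw [h]
  rw [sum_pi_prod N (fun _ y => w y * (if A y then x else 1))]
  have h2 : ∑ y, w y * (if A y then x else 1) =
      (∑ y with A y, w y) * x + (1 - ∑ y with A y, w y) := by
    have h3 : 1 - ∑ y with A y, w y = ∑ y with ¬ A y, w y := by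
      rw [← hw, ← Finset.sum_filter_add_sum_filter_not Finset.univ A w]
      ring
    rw [h3, Finset.sum_mul, Finset.sum_filter, Finset.sum_filter, ← Finset.sum_add_distrib]
    exact Finset.sum_congr rfl fun y _ => by split_ifs <;> simp
  simp only [h2, Finset.prod_const, Finset.card_univ, Fintype.card_fin]

/-- The mean of `1 / (K + 1)` for a binomial count `K` with parameters `N` and `q` is at most
`1 / ((N + 1) q)`. -/
theorem sum_pi_prod_div_card_add_one_le (hw0 : ∀ y, 0 ≤ w y) (hw : ∑ y, w y = 1)
    (hq : 0 < ∑ y with A y, w y) :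
    ∑ ys : Fin N → R, (∏ n, w (ys n)) *
      (1 / ((Finset.univ.filter fun n => A (ys n)).card + 1 : ℝ)) ≤
      1 / ((N + 1) * ∑ y with A y, w y) := by
  set q := ∑ y with A y, w y with hqdef
  have hq1 : q ≤ 1 := by
    rw [← hw]
    exact Finset.sum_le_sum_of_subset_of_nonneg (Finset.filter_subset _ _) fun y _ _ => hw0 y
  -- Uses `1 / (k + 1) = ∫ x in 0..1, x ^ k`.
  have h1 : ∑ ys : Fin N → R, (∏ n, w (ys n)) *
      (1 / ((Finset.univ.filter fun n => A (ys n)).card + 1 : ℝ)) =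
      ∫ x in (0 : ℝ)..1, (q * x + (1 - q)) ^ N := by
    simp_rw [hqdef, ← sum_pi_prod_mul_pow_card N A hw]
    rw [intervalIntegral.integral_finsetSum]
    · simp
    · intro ys _
      exact (by fun_prop : Continuous fun x : ℝ => (∏ n, w (ys n)) *
        x ^ (Finset.univ.filter fun n => A (ys n)).card).intervalIntegrable _ _
  have h2 : ∫ x in (0 : ℝ)..1, (q * x + (1 - q)) ^ N =
      (1 - (1 - q) ^ (N + 1)) / ((N + 1) * q) := by
    have hd : ∀ x ∈ Set.uIcc (0 : ℝ) 1, HasDerivAt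
        (fun x => (q * x + (1 - q)) ^ (N + 1) / ((N + 1) * q)) ((q * x + (1 - q)) ^ N) x := by
      intro x _
      have h3 : HasDerivAt (fun x => q * x + (1 - q)) q x := by
        simpa using ((hasDerivAt_id x).const_mul q).add_const (1 - q)
      convert! (h3.pow (N + 1)).div_const ((N + 1) * q) using 1
      have : (N : ℝ) + 1 ≠ 0 := by positivity
      push_cast
      field_simp
    rw [intervalIntegral.integral_eq_sub_of_hasDerivAt hd
      ((by fun_prop : Continuous fun x : ℝ => (q * x + (1 - q)) ^ N).intervalIntegrable _ _)]
    rw [← sub_div]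
    simp
  rw [h1, h2]
  gcongr
  have : 0 ≤ (1 - q) ^ (N + 1) := pow_nonneg (by linarith) _
  linarith

/-- Jensen's inequality for `z ↦ 1 / (a + b z)` at a binomial count. -/
theorem le_sum_pi_prod_div (hw0 : ∀ y, 0 ≤ w y) (hw : ∑ y, w y = 1) {a b : ℝ} (ha : 0 < a)
    (hb : 0 ≤ b) :
    1 / (a + b * (N * ∑ y with A y, w y)) ≤ ∑ ys : Fin N → R, (∏ n, w (ys n)) *
      (1 / (a + b * ((Finset.univ.filter fun n => A (ys n)).card : ℝ))) := by
  set q := ∑ y with A y, w y with hqdef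
  have hq : 0 ≤ q := Finset.sum_nonneg fun y _ => hw0 y
  set z := a + b * (N * q) with hz
  have hz0 : 0 < z := by positivity
  -- The tangent to `x ↦ 1 / x` at the mean `z` lies below the graph; the gap is an explicit square
  -- over a positive number.
  have htan : ∀ ys : Fin N → R,
      (∏ n, w (ys n)) * (2 / z - a / z ^ 2) - b / z ^ 2 * ((∏ n, w (ys n)) *
        ((Finset.univ.filter fun n => A (ys n)).card : ℝ)) ≤ (∏ n, w (ys n)) *
      (1 / (a + b * ((Finset.univ.filter fun n => A (ys n)).card : ℝ))) := by
    intro ys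
    have h0 : 0 ≤ ∏ n, w (ys n) := Finset.prod_nonneg fun n _ => hw0 _
    set k : ℝ := ((Finset.univ.filter fun n => A (ys n)).card : ℝ)
    have hk : 0 < a + b * k := by positivity
    have h1 : (2 / z - a / z ^ 2) - b / z ^ 2 * k ≤ 1 / (a + b * k) := by
      have : 1 / (a + b * k) - ((2 / z - a / z ^ 2) - b / z ^ 2 * k) =
          (z - (a + b * k)) ^ 2 / (z ^ 2 * (a + b * k)) := by
        field_simp
        ring
      have h2 : 0 ≤ (z - (a + b * k)) ^ 2 / (z ^ 2 * (a + b * k)) := by positivity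
      linarith
    calc _ = (∏ n, w (ys n)) * ((2 / z - a / z ^ 2) - b / z ^ 2 * k) := by ring
      _ ≤ _ := mul_le_mul_of_nonneg_left h1 h0
  refine le_trans (le_of_eq ?_) (Finset.sum_le_sum fun ys _ => htan ys)
  rw [Finset.sum_sub_distrib, ← Finset.sum_mul, ← Finset.mul_sum, sum_pi_prod_mul_card N A hw,
    sum_pi_prod_eq_one N hw, ← hqdef]
  field_simp
  rw [hz]
  ring

end Counts

/-! ### The route distribution -/

section Routes

variable {p : ℕ}

theorem gridDist_eq_zero_iff {x y : Vertex p} : gridDist x y = 0 ↔ x = y := by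
  obtain ⟨a, b⟩ := x
  obtain ⟨c, d⟩ := y
  simp only [gridDist, Prod.mk.injEq, Fin.ext_iff]
  omega

theorem exists_adjacent_closer {x z : Vertex p} (h : x ≠ z) :
    ∃ x' : Vertex p, gridDist x x' = 1 ∧ gridDist x' z + 1 = gridDist x z := by
  obtain ⟨⟨a, ha⟩, ⟨b, hb⟩⟩ := x
  obtain ⟨⟨c, hc⟩, ⟨d, hd⟩⟩ := z
  simp only [ne_eq, Prod.mk.injEq, Fin.mk.injEq] at h
  rcases lt_trichotomy a c with h1 | h1 | h1
  · exact ⟨(⟨a + 1, by omega⟩, ⟨b, hb⟩), by simp [gridDist], by simp [gridDist]; omega⟩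
  · rcases lt_trichotomy b d with h2 | h2 | h2
    · exact ⟨(⟨a, ha⟩, ⟨b + 1, by omega⟩), by simp [gridDist], by simp [gridDist]; omega⟩
    · exact absurd ⟨h1, h2⟩ h
    · exact ⟨(⟨a, ha⟩, ⟨b - 1, by omega⟩), by simp [gridDist]; omega, by simp [gridDist]; omega⟩
  · exact ⟨(⟨a - 1, by omega⟩, ⟨b, hb⟩), by simp [gridDist]; omega, by simp [gridDist]; omega⟩

/-- The final distance bound is the induction invariant that excludes repetitions: a prepended
segment starts at distance `d + 2` from `z`, farther than the tail of any segment already present.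
-/
theorem exists_shortest_list (d : ℕ) : ∀ x z : Vertex p, gridDist x z = d + 1 →
    ∃ (l : List (Segment p)) (h : l ≠ []), l.Nodup ∧ l.IsChain (fun s t => s.1.2 = t.1.1) ∧
      (l.head h).1.1 = x ∧ (l.getLast h).1.2 = z ∧ l.length = d + 1 ∧
      ∀ s ∈ l, gridDist s.1.1 z ≤ d + 1 := by
  induction d with
  | zero =>
    intro x z h
    refine ⟨[⟨(x, z), h⟩], by simp, by simp, by simp, by simp, by simp, by simp, ?_⟩
    simp [h]
  | succ d ih =>
    intro x z h
    have hne : x ≠ z := by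
      intro hxz
      rw [gridDist_eq_zero_iff.2 hxz] at h
      omega
    obtain ⟨x', h1, h2⟩ := exists_adjacent_closer hne
    obtain ⟨l, hl, hnd, hch, hhead, hlast, hlen, hdist⟩ := ih x' z (by omega)
    obtain ⟨t, l', rfl⟩ := List.exists_cons_of_ne_nil hl
    refine ⟨⟨(x, x'), h1⟩ :: t :: l', by simp, ?_, ?_, by simp, ?_, by simp [← hlen], ?_⟩
    · rw [List.nodup_cons]
      refine ⟨fun hmem => ?_, hnd⟩
      have := hdist _ hmem
      simp only at this
      omega
    · rw [List.isChain_cons_cons]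
      exact ⟨hhead.symm, hch⟩
    · rw [List.getLast_cons hl]
      exact hlast
    · intro s hs
      rcases List.mem_cons.1 hs with rfl | hs
      · simp [h]
      · exact (hdist s hs).trans (by omega)

theorem fewestTurnRoutes_nonempty {x z : Vertex p} (h : x ≠ z) :
    (fewestTurnRoutes x z).Nonempty := by
  have hne : (shortestRoutes x z).Nonempty := by
    have h0 : gridDist x z ≠ 0 := fun h0 => h (gridDist_eq_zero_iff.1 h0)
    obtain ⟨l, hl, hnd, hch, hhead, hlast, hlen, -⟩ :=
      exists_shortest_list (gridDist x z - 1) x z (by omega)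
    refine ⟨⟨l, hl, hnd, hch⟩, ?_⟩
    rw [shortestRoutes, Finset.mem_filter]
    exact ⟨Finset.mem_univ _, hhead, hlast, by rw [hlen]; omega⟩
  obtain ⟨y, hy, hmin⟩ := Finset.exists_min_image _ Route.turns hne
  exact ⟨y, Finset.mem_filter.2 ⟨hy, hmin⟩⟩

theorem card_segs (y : Route p) : y.segs.card = y.1.length :=
  List.toFinset_card_of_nodup y.2.2.1

theorem segs_nonempty (y : Route p) : y.segs.Nonempty :=
  List.toFinset_nonempty_iff _ |>.2 y.2.1

theorem fewestTurnRoutes_subset (x₁ x₂ : Vertex p) : fewestTurnRoutes x₁ x₂ ⊆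
    Finset.univ.filter (fun y : Route p => (y.origin, y.dest) = (x₁, x₂)) := by
  intro y hy
  rw [fewestTurnRoutes, Finset.mem_filter, shortestRoutes, Finset.mem_filter] at hy
  simp [hy.1.2.1, hy.1.2.2.1]

theorem sum_ite_mem_div_card {R : Type*} {F G : Finset R} [DecidablePred (· ∈ F)]
    (hF : F.Nonempty) (hFG : F ⊆ G) :
    ∑ y ∈ G, (if y ∈ F then 1 / (F.card : ℝ) else 0) = 1 := by
  have h : (F.card : ℝ) ≠ 0 := by exact_mod_cast hF.card_pos.ne'
  rw [← Finset.sum_subset hFG (fun y _ hy => if_neg hy),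
    Finset.sum_congr rfl (fun y hy => if_pos hy), Finset.sum_const, nsmul_eq_mul,
    mul_one_div_cancel h]

/-- Sums over the fibres of (origin, destination): the uniform weights add up to `1` on each fibre
with distinct endpoints, and closed routes have weight zero. Both the total mass and the mean length
follow. -/
theorem sum_routeProb_mul (α : ℝ) (f : Vertex p → Vertex p → ℝ) :
    ∑ y : Route p, routeProb α p y * f y.origin y.dest =
      ∑ x₁, ∑ x₂, odProb α p x₁ x₂ * f x₁ x₂ := by
  classical
  rw [← Fintype.sum_prod_type', ← Finset.sum_fiberwise Finset.univ
    (fun y : Route p => (y.origin, y.dest))]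
  refine Finset.sum_congr rfl fun x _ => ?_
  obtain ⟨x₁, x₂⟩ := x
  by_cases hx : x₁ = x₂
  · subst hx
    refine (Finset.sum_eq_zero fun y hy => ?_).trans (by simp [odProb])
    simp only [Finset.mem_filter, Finset.mem_univ, true_and, Prod.mk.injEq] at hy
    simp [routeProb, hy.1, hy.2, odProb]
  · have hne := fewestTurnRoutes_nonempty hx
    have h1 : ∀ y ∈ Finset.univ.filter (fun y : Route p => (y.origin, y.dest) = (x₁, x₂)),
        routeProb α p y * f y.origin y.dest = odProb α p x₁ x₂ * f x₁ x₂ *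
          if y ∈ fewestTurnRoutes x₁ x₂ then 1 / ((fewestTurnRoutes x₁ x₂).card : ℝ) else 0 := by
      intro y hy
      simp only [Finset.mem_filter, Finset.mem_univ, true_and, Prod.mk.injEq] at hy
      obtain ⟨rfl, rfl⟩ := hy
      rw [routeProb]
      ring
    rw [Finset.sum_congr rfl h1, ← Finset.mul_sum]
    refine (congrArg _ ?_).trans (mul_one _)
    convert! sum_ite_mem_div_card hne (fewestTurnRoutes_subset x₁ x₂)

theorem betaBinomial_pos {α : ℝ} (hα : 0 < α) (k : Fin (p + 1)) : 0 < betaBinomial α p k := by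
  have hk : ((k : ℕ) : ℝ) ≤ p := by exact_mod_cast Nat.lt_succ_iff.1 k.2
  have hc : (0 : ℝ) < p.choose k := by exact_mod_cast Nat.choose_pos (Nat.lt_succ_iff.1 k.2)
  exact div_pos (mul_pos hc (beta_pos (by positivity) (by linarith))) (beta_pos hα hα)

theorem vertexProb_pos {α : ℝ} (hα : 0 < α) (x : Vertex p) : 0 < vertexProb α p x :=
  mul_pos (betaBinomial_pos hα _) (betaBinomial_pos hα _)

theorem odNormalizer_pos {α : ℝ} (hα : 0 < α) (hp : 1 ≤ p) :
    0 < ∑ u : Vertex p, ∑ v : Vertex p, if u = v then 0 else vertexProb α p u * vertexProb α p v := by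
  have h0 : ∀ u v : Vertex p, 0 ≤ if u = v then 0 else vertexProb α p u * vertexProb α p v := by
    intro u v
    split_ifs
    · exact le_rfl
    · exact (mul_pos (vertexProb_pos hα u) (vertexProb_pos hα v)).le
  have hne : ((⟨0, by omega⟩, ⟨0, by omega⟩) : Vertex p) ≠ (⟨1, by omega⟩, ⟨0, by omega⟩) := by
    simp
  refine Finset.sum_pos' (fun u _ => Finset.sum_nonneg fun v _ => h0 u v)
    ⟨(⟨0, by omega⟩, ⟨0, by omega⟩), Finset.mem_univ _, ?_⟩
  refine Finset.sum_pos' (fun v _ => h0 _ v)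
    ⟨(⟨1, by omega⟩, ⟨0, by omega⟩), Finset.mem_univ _, ?_⟩
  rw [if_neg hne]
  exact mul_pos (vertexProb_pos hα _) (vertexProb_pos hα _)

theorem odProb_nonneg {α : ℝ} (hα : 0 < α) (x₁ x₂ : Vertex p) : 0 ≤ odProb α p x₁ x₂ := by
  unfold odProb
  split_ifs
  · exact le_rfl
  · refine div_nonneg (mul_pos (vertexProb_pos hα _) (vertexProb_pos hα _)).le
      (Finset.sum_nonneg fun u _ => Finset.sum_nonneg fun v _ => ?_)
    split_ifs
    · exact le_rfl
    · exact (mul_pos (vertexProb_pos hα u) (vertexProb_pos hα v)).le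

theorem routeProb_nonneg {α : ℝ} (hα : 0 < α) (y : Route p) : 0 ≤ routeProb α p y := by
  refine mul_nonneg (odProb_nonneg hα _ _) ?_
  split_ifs <;> positivity

theorem sum_routeProb {α : ℝ} (hα : 0 < α) (hp : 1 ≤ p) : ∑ y : Route p, routeProb α p y = 1 := by
  have h := sum_routeProb_mul (p := p) α (fun _ _ => 1)
  simp only [mul_one] at h
  rw [h]
  have h2 : ∀ x₁ x₂ : Vertex p, odProb α p x₁ x₂ =
      (if x₁ = x₂ then 0 else vertexProb α p x₁ * vertexProb α p x₂) /
      ∑ u : Vertex p, ∑ v : Vertex p, if u = v then 0 else vertexProb α p u * vertexProb α p v := by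
    intro x₁ x₂
    unfold odProb
    split_ifs <;> simp
  simp_rw [h2, ← Finset.sum_div]
  exact div_self (odNormalizer_pos hα hp).ne'

theorem sum_routeProb_mul_card (α : ℝ) :
    ∑ y : Route p, routeProb α p y * (y.segs.card : ℝ) =
      ∑ x₁ : Vertex p, ∑ x₂, odProb α p x₁ x₂ * (gridDist x₁ x₂ : ℝ) := by
  rw [← sum_routeProb_mul α (fun x₁ x₂ => (gridDist x₁ x₂ : ℝ))]
  refine Finset.sum_congr rfl fun y _ => ?_
  by_cases hy : y ∈ fewestTurnRoutes y.origin y.dest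
  · rw [fewestTurnRoutes, Finset.mem_filter, shortestRoutes, Finset.mem_filter] at hy
    rw [card_segs, hy.1.2.2.2]
  · simp [routeProb, hy]

end Routes

/-! ### The mean length of a route -/

section Length

variable {α : ℝ} {p : ℕ}

/-- The weights are reversible for the birth-death chain with up-rate `(p - k)(α + k)` and down-rate
`k (α + p - k)`, by the recursions of the binomial coefficients and of `Γ`. The moments then follow
without evaluating the total mass. -/
theorem betaBinomial_succ (hα : 0 < α) {k : ℕ} (hk : k < p) :
    betaBinomial α p ⟨k + 1, by omega⟩ * (((k + 1 : ℕ) : ℝ) * (α + p - (k + 1 : ℕ))) =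
      betaBinomial α p ⟨k, by omega⟩ * ((p - k) * (α + k)) := by
  have hc : (p.choose (k + 1) : ℝ) * (k + 1) = p.choose k * (p - k) := by
    have := Nat.choose_succ_right_eq p k
    rw [← Nat.cast_sub hk.le]
    exact_mod_cast this
  have hkp : (k : ℝ) + 1 ≤ p := by exact_mod_cast hk
  have hg1 : Real.Gamma (α + (k + 1)) = (α + k) * Real.Gamma (α + k) := by
    rw [← add_assoc, Real.Gamma_add_one (by positivity)]
  have hg2 : Real.Gamma (α + (p - k)) = (α + p - (k + 1)) * Real.Gamma (α + (p - (k + 1))) := by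
    rw [show α + ((p : ℝ) - k) = (α + (p - (k + 1))) + 1 by ring,
      Real.Gamma_add_one (by linarith)]
    ring
  have hb := (beta_pos hα hα).ne'
  simp only [betaBinomial, beta]
  push_cast
  rw [show α + ((k : ℝ) + 1) + (α + (p - (k + 1))) = 2 * α + p by ring,
    show α + (k : ℝ) + (α + (p - k)) = 2 * α + p by ring, hg1, hg2]
  calc _ = (p.choose (k + 1) * ((k : ℝ) + 1)) * ((α + k) * Real.Gamma (α + k) *
        Real.Gamma (α + (p - (k + 1))) / Real.Gamma (2 * α + p)) * (α + p - (k + 1)) /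
        (Real.Gamma α * Real.Gamma α / Real.Gamma (α + α)) := by ring
    _ = _ := by rw [hc]; ring

/-- Detailed balance for the beta-binomial weights. -/
theorem sum_betaBinomial_balance (hα : 0 < α) (f : ℝ → ℝ) :
    ∑ k : Fin (p + 1), betaBinomial α p k * ((k : ℕ) * (α + p - (k : ℕ))) * f ((k : ℕ) - 1) =
      ∑ k : Fin (p + 1), betaBinomial α p k * ((p - (k : ℕ)) * (α + (k : ℕ))) * f (k : ℕ) := by
  rw [Fin.sum_univ_succ, Fin.sum_univ_castSucc]
  simp only [Fin.val_zero, Nat.cast_zero, zero_mul, mul_zero, zero_add, Fin.val_last, sub_self,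
    add_zero]
  refine Finset.sum_congr rfl fun k _ => ?_
  have h := betaBinomial_succ hα k.2
  have h1 : (⟨(k : ℕ) + 1, by omega⟩ : Fin (p + 1)) = k.succ := rfl
  have h2 : (⟨(k : ℕ), by omega⟩ : Fin (p + 1)) = k.castSucc := rfl
  rw [h1, h2] at h
  simp only [Fin.val_succ, Fin.val_castSucc]
  rw [h]
  push_cast
  ring_nf

theorem sum_betaBinomial_mul (hα : 0 < α) :
    ∑ k : Fin (p + 1), betaBinomial α p k * (k : ℕ) =
      p / 2 * ∑ k : Fin (p + 1), betaBinomial α p k := by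
  -- With `f = 1`, the difference of the two rates is linear: `2 α k - p α`.
  have h := sum_betaBinomial_balance (p := p) hα (fun _ => 1)
  rw [← sub_eq_zero, ← Finset.sum_sub_distrib] at h
  have h2 : ∑ k : Fin (p + 1), betaBinomial α p k * (k : ℕ) * (2 * α) -
      ∑ k : Fin (p + 1), betaBinomial α p k * (p * α) = 0 := by
    rw [← Finset.sum_sub_distrib, ← h]
    exact Finset.sum_congr rfl fun k _ => by ring
  rw [← Finset.sum_mul, ← Finset.sum_mul] at h2
  have h3 : (2 * α) * (∑ k : Fin (p + 1), betaBinomial α p k * (k : ℕ) -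
      p / 2 * ∑ k : Fin (p + 1), betaBinomial α p k) = 0 := by linarith
  rcases mul_eq_zero.1 h3 with h4 | h4
  · linarith
  · linarith

theorem sum_betaBinomial_mul_sq (hα : 0 < α) :
    (2 * α + 1) * ∑ k : Fin (p + 1), betaBinomial α p k * ((k : ℕ) : ℝ) ^ 2 =
      (p * α + α + p) * (p / 2) * ∑ k : Fin (p + 1), betaBinomial α p k := by
  -- With `f x = x`, the cubic terms cancel and `k ((2 α + 1) k - (p α + α + p))` remains.
  have h := sum_betaBinomial_balance (p := p) hα (fun x => x)
  rw [← sub_eq_zero, ← Finset.sum_sub_distrib] at h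
  have h2 : (2 * α + 1) * ∑ k : Fin (p + 1), betaBinomial α p k * ((k : ℕ) : ℝ) ^ 2 -
      (p * α + α + p) * ∑ k : Fin (p + 1), betaBinomial α p k * (k : ℕ) = 0 := by
    rw [Finset.mul_sum, Finset.mul_sum, ← Finset.sum_sub_distrib, ← h]
    exact Finset.sum_congr rfl fun k _ => by ring
  rw [sum_betaBinomial_mul hα] at h2
  linarith

theorem sum_sum_betaBinomial_sq_sub (hα : 0 < α) (hα1 : α ≤ 1) :
    (p : ℝ) ^ 2 / 6 * (∑ k : Fin (p + 1), betaBinomial α p k) ^ 2 ≤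
      ∑ k : Fin (p + 1), ∑ l : Fin (p + 1), betaBinomial α p k * betaBinomial α p l *
        (((k : ℕ) : ℝ) - (l : ℕ)) ^ 2 := by
  set M := ∑ k : Fin (p + 1), betaBinomial α p k with hM
  set Q := ∑ k : Fin (p + 1), betaBinomial α p k * ((k : ℕ) : ℝ) ^ 2 with hQ
  have h1 := sum_betaBinomial_mul (p := p) hα
  have h2 := sum_betaBinomial_mul_sq (p := p) hα
  rw [← hM] at h1
  rw [← hM, ← hQ] at h2
  have h3 : ∑ k : Fin (p + 1), ∑ l : Fin (p + 1), betaBinomial α p k * betaBinomial α p l *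
        (((k : ℕ) : ℝ) - (l : ℕ)) ^ 2 = 2 * (M * Q) - 2 * (p / 2 * M) ^ 2 := by
    have e1 : M * Q = ∑ k : Fin (p + 1), ∑ l : Fin (p + 1),
        betaBinomial α p k * (betaBinomial α p l * ((l : ℕ) : ℝ) ^ 2) := by
      rw [hM, hQ, Finset.sum_mul_sum]
    have e2 : M * Q = ∑ k : Fin (p + 1), ∑ l : Fin (p + 1),
        betaBinomial α p k * ((k : ℕ) : ℝ) ^ 2 * betaBinomial α p l := by
      rw [mul_comm, hM, hQ, Finset.sum_mul_sum]
    have e3 : 2 * (M * Q) = _ := (two_mul (M * Q)).trans (congrArg₂ (· + ·) e1 e2)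
    rw [← h1, sq (∑ k : Fin (p + 1), betaBinomial α p k * (k : ℕ)), e3, Finset.sum_mul_sum, ← Finset.sum_add_distrib, Finset.mul_sum,
      ← Finset.sum_sub_distrib]
    refine Finset.sum_congr rfl fun k _ => ?_
    rw [Finset.mul_sum, ← Finset.sum_add_distrib, ← Finset.sum_sub_distrib]
    exact Finset.sum_congr rfl fun l _ => by ring
  have hQ' : Q = (p * α + α + p) * (p / 2) * M / (2 * α + 1) := by
    rw [eq_div_iff (by positivity)]
    linarith
  rw [h3, hQ']
  -- The excess over `p² M² / 6` is nonnegative exactly because `α ≤ 1` makes `p (1 - α) + 3 α ≥ 0`.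
  have h4 : 2 * (M * ((p * α + α + p) * (p / 2) * M / (2 * α + 1))) - 2 * (p / 2 * M) ^ 2 -
      (p : ℝ) ^ 2 / 6 * M ^ 2 = M ^ 2 * p * (p * (1 - α) + 3 * α) / (3 * (2 * α + 1)) := by
    field_simp
    ring
  have h5 : 0 ≤ M ^ 2 * p * (p * (1 - α) + 3 * α) / (3 * (2 * α + 1)) := by
    have : 0 ≤ 1 - α := by linarith
    positivity
  linarith

/-- The mean length of a random route is at least `p / 6`. -/
theorem le_sum_routeProb_mul_card (hα : 0 < α) (hα1 : α ≤ 1) (hp : 1 ≤ p) :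
    (p : ℝ) / 6 ≤ ∑ y : Route p, routeProb α p y * (y.segs.card : ℝ) := by
  have hp0 : (0 : ℝ) < p := by exact_mod_cast hp
  set Z := ∑ u : Vertex p, ∑ v : Vertex p,
    if u = v then 0 else vertexProb α p u * vertexProb α p v with hZ
  have hZ0 : 0 < Z := odNormalizer_pos hα hp
  set M := ∑ k : Fin (p + 1), betaBinomial α p k with hM
  have hV : ∀ f : Fin (p + 1) → ℝ, ∑ u : Vertex p, vertexProb α p u * f u.1 =
      M * ∑ k, betaBinomial α p k * f k := by
    intro f
    rw [Fintype.sum_prod_type, hM, mul_comm, Finset.sum_mul_sum]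
    exact Finset.sum_congr rfl fun k _ => Finset.sum_congr rfl fun l _ => by
      simp only [vertexProb]; ring
  have hV1 : ∑ u : Vertex p, vertexProb α p u = M ^ 2 := by
    have := hV (fun _ => 1)
    simp only [mul_one] at this
    rw [this, sq]
  have hZle : Z ≤ M ^ 4 := by
    rw [show M ^ 4 = M ^ 2 * M ^ 2 by ring, ← hV1, Finset.sum_mul_sum]
    refine Finset.sum_le_sum fun u _ => Finset.sum_le_sum fun v _ => ?_
    split_ifs
    · exact (mul_pos (vertexProb_pos hα u) (vertexProb_pos hα v)).le
    · exact le_rfl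
  -- One coordinate suffices: as `|i - j| ≤ p`, the distance is at least `(i - j)² / p`, which
  -- reduces the mean length to second moments.
  have hdist : ∀ u v : Vertex p,
      (((u.1 : ℕ) : ℝ) - (v.1 : ℕ)) ^ 2 / p ≤ (gridDist u v : ℝ) := by
    intro u v
    have h1 : |((u.1 : ℕ) : ℝ) - (v.1 : ℕ)| ≤ (gridDist u v : ℝ) := by
      have : |((u.1 : ℕ) : ℤ) - (v.1 : ℕ)| ≤ (gridDist u v : ℤ) := by
        rw [abs_le, gridDist]; constructor <;> omega
      exact_mod_cast this
    have h2 : |((u.1 : ℕ) : ℝ) - (v.1 : ℕ)| ≤ p := by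
      have : |((u.1 : ℕ) : ℤ) - (v.1 : ℕ)| ≤ (p : ℤ) := by
        rw [abs_le]; constructor <;> omega
      exact_mod_cast this
    rw [div_le_iff₀ hp0, ← sq_abs, sq]
    exact mul_le_mul h1 h2 (abs_nonneg _) (by positivity)
  have hsum : (p : ℝ) / 6 * M ^ 4 ≤ ∑ u : Vertex p, ∑ v : Vertex p,
      vertexProb α p u * vertexProb α p v * (gridDist u v : ℝ) := by
    have h1 : ∑ u : Vertex p, ∑ v : Vertex p, vertexProb α p u * vertexProb α p v *
        ((((u.1 : ℕ) : ℝ) - (v.1 : ℕ)) ^ 2 / p) ≤ ∑ u : Vertex p, ∑ v : Vertex p,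
        vertexProb α p u * vertexProb α p v * (gridDist u v : ℝ) :=
      Finset.sum_le_sum fun u _ => Finset.sum_le_sum fun v _ =>
        mul_le_mul_of_nonneg_left (hdist u v)
          (mul_pos (vertexProb_pos hα u) (vertexProb_pos hα v)).le
    refine le_trans ?_ h1
    have h2 : ∀ u : Vertex p, ∑ v : Vertex p, vertexProb α p u * vertexProb α p v *
        ((((u.1 : ℕ) : ℝ) - (v.1 : ℕ)) ^ 2 / p) = vertexProb α p u *
        (M / p * ∑ l, betaBinomial α p l * (((u.1 : ℕ) : ℝ) - (l : ℕ)) ^ 2) := by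
      intro u
      have := hV (fun l => (((u.1 : ℕ) : ℝ) - (l : ℕ)) ^ 2)
      rw [div_mul_eq_mul_div, ← this, Finset.sum_div, Finset.mul_sum]
      exact Finset.sum_congr rfl fun v _ => by ring
    simp_rw [h2]
    rw [hV (fun k => M / p * ∑ l, betaBinomial α p l * (((k : ℕ) : ℝ) - (l : ℕ)) ^ 2)]
    have h3 := sum_sum_betaBinomial_sq_sub (p := p) hα hα1
    rw [← hM] at h3
    have h4 : M * ∑ k, betaBinomial α p k *
        (M / p * ∑ l, betaBinomial α p l * (((k : ℕ) : ℝ) - (l : ℕ)) ^ 2) = M ^ 2 / p *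
        ∑ k : Fin (p + 1), ∑ l : Fin (p + 1), betaBinomial α p k * betaBinomial α p l *
        (((k : ℕ) : ℝ) - (l : ℕ)) ^ 2 := by
      simp_rw [Finset.mul_sum]
      exact Finset.sum_congr rfl fun k _ => Finset.sum_congr rfl fun l _ => by ring
    rw [h4]
    calc (p : ℝ) / 6 * M ^ 4 = M ^ 2 / p * ((p : ℝ) ^ 2 / 6 * M ^ 2) := by field_simp
      _ ≤ _ := mul_le_mul_of_nonneg_left h3 (by positivity)
  rw [sum_routeProb_mul_card]
  have hod : ∀ u v : Vertex p, odProb α p u v * (gridDist u v : ℝ) =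
      vertexProb α p u * vertexProb α p v * (gridDist u v : ℝ) / Z := by
    intro u v
    unfold odProb
    split_ifs with h
    · simp [gridDist_eq_zero_iff.2 h]
    · rw [← hZ]; ring
  simp_rw [hod, ← Finset.sum_div]
  rw [le_div_iff₀ hZ0]
  exact (mul_le_mul_of_nonneg_left hZle (by positivity)).trans hsum

end Length

/-! ### Bounds for the integrated risk -/

section Risk

variable {p N : ℕ} {α m : ℝ} {v : ℝ≥0} {S : Matrix (Segment p) (Segment p) ℝ}

theorem ofReal_sum_sum_routeProb (hα : 0 < α) {G : Route p → (Fin N → Route p) → ℝ}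
    (hG : ∀ y ys, 0 ≤ G y ys) :
    ENNReal.ofReal (∑ ys : Fin N → Route p, ∑ y, (∏ n, routeProb α p (ys n)) * routeProb α p y *
      G y ys) = ∑ ys : Fin N → Route p, ∑ y,
        ENNReal.ofReal ((∏ n, routeProb α p (ys n)) * routeProb α p y) *
          ENNReal.ofReal (G y ys) := by
  have h0 : ∀ (ys : Fin N → Route p) y, 0 ≤ (∏ n, routeProb α p (ys n)) * routeProb α p y :=
    fun ys y => mul_nonneg (Finset.prod_nonneg fun n _ => routeProb_nonneg hα _)
      (routeProb_nonneg hα y)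
  rw [ENNReal.ofReal_sum_of_nonneg fun ys _ => Finset.sum_nonneg fun y _ =>
    mul_nonneg (h0 ys y) (hG y ys)]
  refine Finset.sum_congr rfl fun ys _ => ?_
  rw [ENNReal.ofReal_sum_of_nonneg fun y _ => mul_nonneg (h0 ys y) (hG y ys)]
  exact Finset.sum_congr rfl fun y _ => ENNReal.ofReal_mul (h0 ys y)

theorem le_risk (hα : 0 < α) {T : Estimator p N} {G : Route p → (Fin N → Route p) → ℝ}
    (hG : ∀ y ys, 0 ≤ G y ys)
    (hT : ∀ y ys, ENNReal.ofReal (G y ys) ≤ conditionalRisk m v S T y ys) :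
    ENNReal.ofReal (∑ ys : Fin N → Route p, ∑ y, (∏ n, routeProb α p (ys n)) * routeProb α p y *
      G y ys) ≤ risk α m v S T := by
  rw [ofReal_sum_sum_routeProb hα hG]
  exact Finset.sum_le_sum fun ys _ => Finset.sum_le_sum fun y _ => by gcongr; exact hT y ys

theorem risk_le (hα : 0 < α) {T : Estimator p N} {G : Route p → (Fin N → Route p) → ℝ}
    (hG : ∀ y ys, 0 ≤ G y ys)
    (hT : ∀ y ys, conditionalRisk m v S T y ys ≤ ENNReal.ofReal (G y ys)) :
    risk α m v S T ≤ ENNReal.ofReal (∑ ys : Fin N → Route p, ∑ y,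
      (∏ n, routeProb α p (ys n)) * routeProb α p y * G y ys) := by
  rw [ofReal_sum_sum_routeProb hα hG]
  exact Finset.sum_le_sum fun ys _ => Finset.sum_le_sum fun y _ => by gcongr; exact hT y ys

/-- Brings the average over historical routes inside, so that it involves only a single binomial
count `N_s`. -/
theorem sum_sum_routeProb_comm (g : Segment p → ℕ → ℝ) :
    ∑ ys : Fin N → Route p, ∑ y, (∏ n, routeProb α p (ys n)) * routeProb α p y *
      ∑ s ∈ y.segs, g s (traversals ys s) = ∑ y, routeProb α p y *
      ∑ s ∈ y.segs, ∑ ys : Fin N → Route p, (∏ n, routeProb α p (ys n)) *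
        g s (traversals ys s) := by
  rw [Finset.sum_comm]
  refine Finset.sum_congr rfl fun y _ => ?_
  rw [Finset.sum_comm, Finset.mul_sum]
  refine Finset.sum_congr rfl fun ys _ => ?_
  rw [Finset.mul_sum, Finset.mul_sum]
  exact Finset.sum_congr rfl fun s _ => by ring

variable (α) in
/-- The probability that a random route traverses the segment `s`. -/
noncomputable def segmentProb (s : Segment p) : ℝ :=
  ∑ y : Route p with s ∈ y.segs, routeProb α p y

theorem segmentProb_nonneg (hα : 0 < α) (s : Segment p) : 0 ≤ segmentProb α s :=
  Finset.sum_nonneg fun y _ => routeProb_nonneg hα y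

variable (α) in
/-- A lower bound for the integrated risk of all estimators. -/
noncomputable def riskLowerBound (p N : ℕ) (a b : ℝ) : ℝ :=
  ∑ y : Route p, routeProb α p y * ∑ s ∈ y.segs, 1 / (a + b * (N * segmentProb α s))

theorem riskLowerBound_pos (hα : 0 < α) (hp : 1 ≤ p) {a b : ℝ} (ha : 0 < a) (hb : 0 ≤ b) :
    0 < riskLowerBound α p N a b := by
  have h1 : ∀ y : Route p, 0 < ∑ s ∈ y.segs, 1 / (a + b * (N * segmentProb α s)) := fun y =>
    Finset.sum_pos (fun s _ => by have := segmentProb_nonneg hα s; positivity) (segs_nonempty y)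
  obtain ⟨y, -, hy⟩ : ∃ y ∈ (Finset.univ : Finset (Route p)), 0 < routeProb α p y :=
    Finset.exists_lt_of_sum_lt (by simp [sum_routeProb hα hp])
  exact Finset.sum_pos' (fun y _ => mul_nonneg (routeProb_nonneg hα y) (h1 y).le)
    ⟨y, Finset.mem_univ _, mul_pos hy (h1 y)⟩

theorem riskLowerBound_le_risk (hα : 0 < α) (hp : 1 ≤ p) (hv : 0 < v) (hS : S.PosDef) {b : ℝ}
    (hb0 : 0 ≤ b) (hb : ∀ s, ∑ t, |S⁻¹ s t| ≤ b) {T : Estimator p N} (hT : T.IsMeasurable) :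
    ENNReal.ofReal (riskLowerBound α p N (1 / v) b) ≤ risk α m v S T := by
  have hv' : (0 : ℝ) < v := hv
  refine le_trans (ENNReal.ofReal_le_ofReal ?_) (le_risk hα
    (G := fun y ys => ∑ s ∈ y.segs, 1 / (1 / (v : ℝ) + b * traversals ys s))
    (fun y ys => Finset.sum_nonneg fun s _ => by positivity)
    (fun y ys => le_conditionalRisk m hv hS hb T hT y ys))
  rw [sum_sum_routeProb_comm (fun _ k => 1 / (1 / (v : ℝ) + b * k))]
  refine Finset.sum_le_sum fun y _ => mul_le_mul_of_nonneg_left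
    (Finset.sum_le_sum fun s _ => ?_) (routeProb_nonneg hα y)
  exact le_sum_pi_prod_div N (fun y : Route p => s ∈ y.segs) (routeProb_nonneg hα)
    (sum_routeProb hα hp) (one_div_pos.2 hv') hb0

/-- The mean is at most both `1` and `1 / ((N + 1) q)`. If `N q ≤ 1`, then `a + b N q ≤ a + b` and
the first bound suffices; otherwise `a + b N q ≤ (a + b) N q` and the second does. -/
theorem sum_prod_routeProb_div_le (hα : 0 < α) (hp : 1 ≤ p) {a b : ℝ} (ha : 0 < a) (hb : 0 ≤ b)
    {s : Segment p} (hs : 0 < segmentProb α s) :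
    ∑ ys : Fin N → Route p, (∏ n, routeProb α p (ys n)) * (1 / (traversals ys s + 1 : ℝ)) ≤
      2 * (a + b) * (1 / (a + b * (N * segmentProb α s))) := by
  set q := segmentProb α s with hq
  have h1 : ∑ ys : Fin N → Route p, (∏ n, routeProb α p (ys n)) *
      (1 / (traversals ys s + 1 : ℝ)) ≤ 1 / ((N + 1) * q) :=
    sum_pi_prod_div_card_add_one_le N (fun y : Route p => s ∈ y.segs) (routeProb_nonneg hα)
      (sum_routeProb hα hp) hs
  have h2 : ∑ ys : Fin N → Route p, (∏ n, routeProb α p (ys n)) *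
      (1 / (traversals ys s + 1 : ℝ)) ≤ 1 := by
    refine le_of_le_of_eq ?_ (sum_pi_prod_eq_one N (sum_routeProb (p := p) hα hp))
    refine Finset.sum_le_sum fun ys _ => mul_le_of_le_one_right
      (Finset.prod_nonneg fun n _ => routeProb_nonneg hα _) ?_
    rw [div_le_one (by positivity)]
    have : (0 : ℝ) ≤ traversals ys s := by positivity
    linarith
  have hden : 0 < a + b * (N * q) := by positivity
  rw [mul_one_div]
  rcases le_total (N * q) 1 with h | h
  · refine h2.trans ?_
    rw [one_le_div hden]
    nlinarith [mul_le_mul_of_nonneg_left h hb]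
  · refine h1.trans ?_
    rw [div_le_div_iff₀ (by positivity) hden]
    have h3 : (0 : ℝ) ≤ (a + b) * q := by positivity
    have h4 : (0 : ℝ) ≤ b * (N * q) := by positivity
    nlinarith [mul_le_mul_of_nonneg_left h ha.le]

theorem isMeasurable_segmentEstimator (φ : Segment p → ℕ → ℝ) :
    (segmentEstimator N m φ).IsMeasurable := by
  intro y ys
  unfold segmentEstimator
  fun_prop

/-- At `n = 0` only the prior variance `v` is left. For `n ≥ 1` both terms are `O(1 / n)`, and `1 /
n ≤ 2 / (n + 1)`. -/
theorem sq_weight_le {v b C : ℝ} (hv : 0 ≤ v) (hb : 0 ≤ b) (hC : 0 ≤ C) {φ : ℕ → ℝ}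
    (h0 : φ 0 = 0) (h1 : ∀ n, 1 ≤ n → |1 - φ n| ≤ C / Real.sqrt n) (n : ℕ) :
    v * (1 - φ n) ^ 2 + b * (φ n ^ 2 / n) ≤
      (v + 2 * v * C ^ 2 + 2 * b * (1 + C) ^ 2) * (1 / (n + 1)) := by
  rcases Nat.eq_zero_or_pos n with rfl | hn
  · have : 0 ≤ 2 * v * C ^ 2 + 2 * b * (1 + C) ^ 2 := by positivity
    simp [h0]
    linarith
  · have hn1 : (1 : ℝ) ≤ n := by exact_mod_cast hn
    have h2 := h1 n hn
    have h3 : (1 - φ n) ^ 2 ≤ C ^ 2 / n := by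
      rw [← sq_abs]
      calc |1 - φ n| ^ 2 ≤ (C / Real.sqrt n) ^ 2 := by gcongr
        _ = C ^ 2 / n := by rw [div_pow, Real.sq_sqrt (by positivity)]
    have h4 : |1 - φ n| ≤ C := by
      refine h2.trans (div_le_self hC ?_)
      rwa [Real.one_le_sqrt]
    have h5 : φ n ^ 2 ≤ (1 + C) ^ 2 := by
      rw [abs_le] at h4
      apply sq_le_sq'
      · linarith
      · linarith
    have h6 : (1 : ℝ) / n ≤ 2 * (1 / (n + 1)) := by
      rw [mul_one_div, div_le_div_iff₀ (by positivity) (by positivity)]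
      linarith
    calc v * (1 - φ n) ^ 2 + b * (φ n ^ 2 / n)
        ≤ v * (C ^ 2 / n) + b * ((1 + C) ^ 2 / n) := by gcongr
      _ = (v * C ^ 2 + b * (1 + C) ^ 2) * (1 / n) := by ring
      _ ≤ (v * C ^ 2 + b * (1 + C) ^ 2) * (2 * (1 / (n + 1))) := by gcongr
      _ ≤ (v + 2 * v * C ^ 2 + 2 * b * (1 + C) ^ 2) * (1 / (n + 1)) := by
        have : 0 ≤ v * (1 / ((n : ℝ) + 1)) := by positivity
        linarith

/-- The integrated risk of a segment-based estimator is at most a constant multiple of the lower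
bound for the risk of all estimators. -/
theorem risk_segmentEstimator_le (hα : 0 < α) (hp : 1 ≤ p) {a b C : ℝ} (ha : 0 < a)
    (hb0 : 0 ≤ b) (hC : 0 ≤ C) (hS : S.PosDef) (hb : ∀ s, ∑ t, |S s t| ≤ b)
    {φ : Segment p → ℕ → ℝ} (h0 : ∀ s, φ s 0 = 0)
    (h1 : ∀ s n, 1 ≤ n → |1 - φ s n| ≤ C / Real.sqrt n) :
    risk α m v S (segmentEstimator N m φ) ≤ ENNReal.ofReal
      ((v + 2 * v * C ^ 2 + 2 * b * (1 + C) ^ 2) * (2 * (a + b)) * riskLowerBound α p N a b) := by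
  set K : ℝ := v + 2 * v * C ^ 2 + 2 * b * (1 + C) ^ 2 with hK
  have hK0 : 0 ≤ K := by positivity
  refine (risk_le hα (G := fun y ys => ∑ s ∈ y.segs, K * (1 / (traversals ys s + 1 : ℝ)))
    (fun y ys => Finset.sum_nonneg fun s _ => by positivity) (fun y ys => ?_)).trans
    (ENNReal.ofReal_le_ofReal ?_)
  · refine (conditionalRisk_segmentEstimator_le m v hS hb h0 y ys).trans
      (ENNReal.ofReal_le_ofReal (Finset.sum_le_sum fun s _ => ?_))
    exact sq_weight_le v.2 hb0 hC (h0 s) (h1 s) _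
  · rw [sum_sum_routeProb_comm (fun _ k => K * (1 / (k + 1 : ℝ))), riskLowerBound, Finset.mul_sum]
    refine Finset.sum_le_sum fun y _ => ?_
    rw [mul_left_comm]
    -- Routes of probability zero drop out; each segment of any other route has `q_s > 0`, as the
    -- binomial bound requires.
    rcases (routeProb_nonneg hα y).eq_or_lt with hy | hy
    · simp [← hy]
    · refine mul_le_mul_of_nonneg_left ?_ hy.le
      rw [Finset.mul_sum]
      refine Finset.sum_le_sum fun s hs => ?_
      have hq : 0 < segmentProb α s := hy.trans_le
        (Finset.single_le_sum (f := fun y => routeProb α p y)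
          (fun y _ => routeProb_nonneg hα y) (by simpa using hs))
      simp_rw [mul_left_comm _ K, ← Finset.mul_sum]
      rw [mul_assoc K]
      exact mul_le_mul_of_nonneg_left (sum_prod_routeProb_div_le hα hp ha hb0 hq) hK0

theorem traversals_le (ys : Fin N → Route p) (s : Segment p) : traversals ys s ≤ N :=
  (Finset.card_filter_le _ _).trans (by simp)

/-- A lower bound for the integrated risk in terms of the numbers of segments and of trips. -/
theorem le_risk_of_length (hα : 0 < α) (hα1 : α ≤ 1) (hp : 1 ≤ p) (hv : 0 < v) (hS : S.PosDef)
    {b : ℝ} (hb0 : 0 ≤ b) (hb : ∀ s, ∑ t, |S⁻¹ s t| ≤ b) {T : Estimator p N}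
    (hT : T.IsMeasurable) :
    ENNReal.ofReal ((p : ℝ) / 6 * (1 / (1 / v + b * N))) ≤ risk α m v S T := by
  have hv' : (0 : ℝ) < v := hv
  refine le_trans (ENNReal.ofReal_le_ofReal ?_) (le_risk hα
    (G := fun y _ => y.segs.card * (1 / (1 / v + b * N)))
    (fun y ys => by positivity)
    (fun y ys => le_trans (ENNReal.ofReal_le_ofReal ?_)
      (le_conditionalRisk m hv hS hb T hT y ys)))
  · have h : ∀ ys : Fin N → Route p, ∑ y : Route p, (∏ n, routeProb α p (ys n)) *
        routeProb α p y * (y.segs.card * (1 / (1 / (v : ℝ) + b * N))) =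
        (∏ n, routeProb α p (ys n)) * ((∑ y : Route p, routeProb α p y * (y.segs.card : ℝ)) *
          (1 / (1 / (v : ℝ) + b * N))) := by
      intro ys
      rw [Finset.sum_mul, Finset.mul_sum]
      exact Finset.sum_congr rfl fun y _ => by ring
    simp_rw [h]
    rw [← Finset.sum_mul, sum_pi_prod_eq_one N (sum_routeProb hα hp), one_mul]
    exact mul_le_mul_of_nonneg_right (le_sum_routeProb_mul_card hα hα1 hp) (by positivity)
  · rw [← nsmul_eq_mul]
    refine Finset.card_nsmul_le_sum _ _ _ fun s _ => ?_
    have : (traversals ys s : ℝ) ≤ N := by exact_mod_cast traversals_le ys s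
    gcongr

end Risk

end GridTravel

/-! ### The two asymptotic claims -/

open GridTravel
theorem mainTheorem1 (α : ℝ) (hα0 : 0 < α) (hα1 : α ≤ 1) (m : ℝ) (v : ℝ≥0) (hv : 0 < v)
    (S : ∀ p : ℕ, Matrix (Segment p) (Segment p) ℝ) (hS : CovarianceCondition S)
    (N : ℕ → ℕ) :
    (1 / 2 ≤ α → Tendsto (fun p : ℕ => (N p : ℝ) / (p : ℝ)) atTop atTop →
      ∀ φ : ∀ p : ℕ, Segment p → ℕ → ℝ, SimpleWeights φ →
        ∃ C : ℝ, ∀ᶠ p : ℕ in atTop,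
          0 < optimalRisk p (N p) α m v (S p) ∧
          optimalRisk p (N p) α m v (S p) < ⊤ ∧
          risk α m v (S p) (segmentEstimator (N p) m (φ p)) / optimalRisk p (N p) α m v (S p) ≤
            ENNReal.ofReal (C * Real.log (p : ℝ))) ∧
    ((fun p : ℕ => (N p : ℝ)) =O[atTop] (fun p : ℕ => (p : ℝ)) →
      ∀ T : ∀ p : ℕ, Estimator p (N p), (∀ p, (T p).IsMeasurable) →
        0 < liminf (fun p : ℕ => risk α m v (S p) (T p)) atTop) := by
  obtain ⟨hpd, ⟨C₀, hC₀⟩, -⟩ := hS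
  have hv' : (0 : ℝ) < v := hv
  have ha : (0 : ℝ) < 1 / v := one_div_pos.2 hv'
  -- One `b` serves for both `S` and `S⁻¹`, so the same `riskLowerBound` appears in the upper and
  -- the lower estimate and cancels in the ratio.
  set b : ℝ := max C₀ 0 with hb
  have hb0 : 0 ≤ b := le_max_right _ _
  have hbS : ∀ p s, ∑ t, |S p s t| ≤ b := fun p s => (hC₀ p s).1.trans (le_max_left _ _)
  have hbI : ∀ p s, ∑ t, |(S p)⁻¹ s t| ≤ b := fun p s => (hC₀ p s).2.trans (le_max_left _ _)
  constructor
  · rintro - - φ ⟨hφ0, C, hC⟩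
    have hC' : ∀ p s n, 1 ≤ n → |1 - φ p s n| ≤ max C 0 / Real.sqrt n := fun p s n hn =>
      (hC p s n hn).trans (by gcongr; exact le_max_left _ _)
    set K : ℝ := (v + 2 * v * max C 0 ^ 2 + 2 * b * (1 + max C 0) ^ 2) * (2 * (1 / v + b)) with hK
    have hK0 : 0 ≤ K := by positivity
    refine ⟨K, ?_⟩
    -- From `p ≥ 3 > e` on, `log p ≥ 1`, so the constant bound `K` on the ratio is at most `K log
    -- p`.
    filter_upwards [eventually_ge_atTop 3] with p hp3
    have hp : 1 ≤ p := by omega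
    have hLB := riskLowerBound_pos (N := N p) hα0 hp ha hb0
    have hseg := risk_segmentEstimator_le (m := m) (v := v) (N := N p) hα0 hp ha hb0
      (le_max_right C 0) (hpd p) (hbS p) (hφ0 p) (hC' p)
    have hopt : ENNReal.ofReal (riskLowerBound α p (N p) (1 / v) b) ≤
        optimalRisk p (N p) α m v (S p) :=
      le_iInf₂ fun T hT => riskLowerBound_le_risk hα0 hp hv (hpd p) hb0 (hbI p) hT
    refine ⟨(ENNReal.ofReal_pos.2 hLB).trans_le hopt,
      ((iInf₂_le _ (isMeasurable_segmentEstimator (φ p))).trans hseg).trans_lt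
        ENNReal.ofReal_lt_top, ?_⟩
    refine ENNReal.div_le_of_le_mul ?_
    have hlog : 1 ≤ Real.log p := by
      rw [Real.le_log_iff_exp_le (by positivity)]
      have : (3 : ℝ) ≤ p := by exact_mod_cast hp3
      linarith [Real.exp_one_lt_d9]
    calc risk α m v (S p) (segmentEstimator (N p) m (φ p))
        ≤ ENNReal.ofReal (K * riskLowerBound α p (N p) (1 / v) b) := hseg
      _ = ENNReal.ofReal K * ENNReal.ofReal (riskLowerBound α p (N p) (1 / v) b) :=
        ENNReal.ofReal_mul hK0
      _ ≤ ENNReal.ofReal (K * Real.log p) * optimalRisk p (N p) α m v (S p) := by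
        gcongr
        exact le_mul_of_one_le_right hK0 hlog
  · intro hN T hT
    obtain ⟨c, hc0, hc⟩ := hN.exists_pos
    rw [Asymptotics.isBigOWith_iff] at hc
    have hpos : 0 < ENNReal.ofReal (1 / (6 * (1 / v + b * c))) :=
      ENNReal.ofReal_pos.2 (by positivity)
    refine hpos.trans_le (le_liminf_of_le (by isBoundedDefault) ?_)
    filter_upwards [hc, eventually_ge_atTop 1] with p hNp hp
    simp only [Real.norm_natCast] at hNp
    refine le_trans (ENNReal.ofReal_le_ofReal ?_)
      (le_risk_of_length (m := m) hα0 hα1 hp hv (hpd p) hb0 (hbI p) (hT p))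
    have hp1 : (1 : ℝ) ≤ p := by exact_mod_cast hp
    -- The cost per segment is at least of order `1 / p`, which the length `p / 6` compensates.
    have hle : 1 / (v : ℝ) + b * N p ≤ p * (1 / v + b * c) := by
      have h1 : b * N p ≤ b * (c * p) := by gcongr
      have h2 : 1 / (v : ℝ) ≤ p * (1 / v) := le_mul_of_one_le_left ha.le hp1
      linarith
    calc 1 / (6 * (1 / (v : ℝ) + b * c)) = (p : ℝ) / 6 * (1 / (p * (1 / v + b * c))) := by
          field_simp
      _ ≤ (p : ℝ) / 6 * (1 / (1 / v + b * N p)) := by gcongr
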